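/- Let $p$ be a prime, $k$ an algebraically closed field of characteristic $p$, $G$ a finite group and $P$ a $p$-subgroup of $G$. For $H\le G$ let the Scott module $S(G,H)$ be the indecomposable direct summand (unique up to isomorphism) of $\mathrm{Ind}_H^G(k)$ whose socle contains the trivial $kG$-module. For a finite-dimensional $kG$-module $M$ and a $p$-subgroup $Q\le G$ let $M(Q)=M^Q/\sum_{R<Q}M_R^Q$ be the Brauer construction, a $kN_G(Q)$-module, where $M_R^Q=\{\sum_{x\in[Q/R]}xm : m\in M^R\}$; $M$ is called Brauer indecomposable if for every $p$-subgroup $Q\le G$ the module $\mathrm{Res}^{N_G(Q)}_{QC_G(Q)}M(Q)$ is indecomposable or zero. Let $\mathcal F_P(G)$ be the fusion system whose objects are the subgroups of $P$ and whose morphisms $Q\to R$ are the homomorphisms induced by conjugation with elements of $G$. A subgroup $Q\le P$ is fully normalized if $|N_P(R)|\le|N_P(Q)|$ for every $R\le P$ isomorphic to $Q$ in $\mathcal F_P(G)$. Let $\mathrm{core}_G(P)=\bigcap_{x\in G}xPx^{-1}$. Suppose that $\mathcal F_P(G)$ is saturated, and let $M=S(G,P)$. Then the following are equivalent: (1) $M$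 is Brauer indecomposable. (2) $\mathrm{Res}^{N_G(Q)}_{QC_G(Q)}S(N_G(Q),N_P(Q))$ is indecomposable for each fully normalized subgroup $Q$ satisfying $\mathrm{core}_G(P)\le Q\le P$. -/

import Mathlib

/-! ### Fusion systems of finite groups -/

namespace Fusion

variable {G : Type*} [Group G]

/-- `φ : Q → R` is induced by conjugation with an element of `G`; the set of all such `φ` is
`Hom_G(Q, R)`. For `Q, R ≤ P` these are the morphisms of the fusion system `F_P(G)`. -/
def IsConjHom {Q R : Subgroup G} (φ : Q →* R) : Prop :=
  ∃ g : G, ∀ q : Q, (φ q : G) = g * q * g⁻¹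

/-- For `Q, R ≤ P`: `Q` and `R` are isomorphic in `F_P(G)`. -/
def AreConj (Q R : Subgroup G) : Prop :=
  ∃ φ : Q ≃* R, IsConjHom φ.toMonoidHom

/-- The group `Aut_K(Q)` of the automorphisms of `Q` induced by conjugation with elements of `K`
(which necessarily normalize `Q`). -/
def autBy (K Q : Subgroup G) : Subgroup (MulAut Q) where
  carrier := {φ | ∃ g ∈ K, ∀ q : Q, (φ q : G) = g * q * g⁻¹}
  one_mem' := ⟨1, K.one_mem, fun q => by simp⟩
  mul_mem' := by
    rintro φ ψ ⟨g, hg, hφ⟩ ⟨h, hh, hψ⟩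
    exact ⟨g * h, K.mul_mem hg hh, fun q => by
      rw [MulAut.mul_apply, hφ, hψ]; group⟩
  inv_mem' := by
    rintro φ ⟨g, hg, hφ⟩
    refine ⟨g⁻¹, K.inv_mem hg, fun q => ?_⟩
    have h := hφ (φ⁻¹ q)
    rw [MulAut.apply_inv_self] at h
    rw [h]; group

/-- `N_P(Q) = P ∩ N_G(Q)`. -/
def normalizerIn (P Q : Subgroup G) : Subgroup G :=
  P ⊓ Subgroup.normalizer (Q : Set G)

/-- `Q ≤ P` is fully normalized in `F_P(G)`: `|N_P(R)| ≤ |N_P(Q)|` for every `R ≤ P` that is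
isomorphic to `Q` in `F_P(G)`. -/
def IsFullyNormalized (P Q : Subgroup G) : Prop :=
  Q ≤ P ∧ ∀ R : Subgroup G, R ≤ P → AreConj Q R →
    Nat.card (normalizerIn P R) ≤ Nat.card (normalizerIn P Q)

/-- `Q` is fully automized in `F_P(G)`: `Aut_P(Q)` is a Sylow `p`-subgroup of
`Aut_G(Q) = Aut_{F_P(G)}(Q)`. -/
def IsFullyAutomized (p : ℕ) (P Q : Subgroup G) : Prop :=
  ∃ S : Sylow p (autBy ⊤ Q), (S : Subgroup (autBy ⊤ Q)) = (autBy P Q).subgroupOf (autBy ⊤ Q)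

/-- For an isomorphism `φ : R → Q`, the group `N_φ` of all `g ∈ N_P(R)` such that
`φ ∘ c_g ∘ φ⁻¹ ∈ Aut_P(Q)`. -/
def extender (P : Subgroup G) {Q R : Subgroup G} (φ : R ≃* Q) : Subgroup G where
  carrier := {g | g ∈ normalizerIn P R ∧ ∃ α ∈ autBy P Q,
    ∀ (x y : R), (y : G) = g * x * g⁻¹ → φ y = α (φ x)}
  one_mem' := ⟨Subgroup.one_mem _, 1, Subgroup.one_mem _, fun x y h => by
    have : y = x := by ext; simpa using h
    simp [this]⟩
  mul_mem' := by
    rintro g h ⟨hg, α, hα, hgα⟩ ⟨hh, β, hβ, hhβ⟩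
    refine ⟨Subgroup.mul_mem _ hg hh, α * β, Subgroup.mul_mem _ hα hβ, fun x y hxy => ?_⟩
    have hz : h * x * h⁻¹ ∈ R := (Subgroup.mem_normalizer_iff.1 hh.2 x).1 x.2
    rw [MulAut.mul_apply, ← hhβ x ⟨_, hz⟩ rfl, ← hgα ⟨_, hz⟩ y (by rw [hxy]; group)]
  inv_mem' := by
    rintro g ⟨hg, α, hα, hgα⟩
    refine ⟨Subgroup.inv_mem _ hg, α⁻¹, Subgroup.inv_mem _ hα, fun x y hxy => ?_⟩
    have := hgα y x (by rw [hxy]; group)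
    rw [this, MulAut.inv_apply_self]

/-- `Q ≤ P` is receptive in `F_P(G)`: every isomorphism `φ : R → Q` in `F_P(G)` extends to a
morphism `N_φ → P` in `F_P(G)`. -/
def IsReceptive (P Q : Subgroup G) : Prop :=
  ∀ R : Subgroup G, R ≤ P → ∀ φ : R ≃* Q, IsConjHom φ.toMonoidHom →
    ∃ ψ : extender P φ →* P, IsConjHom ψ ∧
      ∀ (x : R) (hx : (x : G) ∈ extender P φ), (ψ ⟨x, hx⟩ : G) = φ x

/-- The fusion system `F_P(G)` is saturated: every subgroup of `P` is isomorphic in `F_P(G)` to a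
subgroup of `P` that is fully automized and receptive. -/
def IsSaturated (p : ℕ) (P : Subgroup G) : Prop :=
  ∀ Q : Subgroup G, Q ≤ P →
    ∃ R : Subgroup G, R ≤ P ∧ AreConj Q R ∧ IsFullyAutomized p P R ∧ IsReceptive P R

end Fusion

/-! ### Indecomposable representations, Scott modules, the Brauer construction -/

namespace Representation

section Indecomposable

variable {k G V : Type*} [Field k] [Group G] [AddCommGroup V] [Module k V]

/-- A representation is indecomposable if it is nonzero and is not the direct sum of two nonzero
subrepresentations. -/
def IsIndecomposable (ρ : Representation k G V) : Prop :=
  Nontrivial V ∧ ∀ A B : Subrepresentation ρ, IsCompl A B → A = ⊥ ∨ B = ⊥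

/-- `S` is an indecomposable direct summand of `ρ` that has a trivial submodule, i.e. a nonzero
vector fixed by the group (equivalently, the trivial module is a direct summand of its socle). -/
def IsScottSummand (ρ : Representation k G V) (S : Subrepresentation ρ) : Prop :=
  (∃ T : Subrepresentation ρ, IsCompl S T) ∧ S.toRepresentation.IsIndecomposable ∧
    S.toRepresentation.invariants ≠ ⊥

theorem isCompl_toSubmodule {ρ : Representation k G V} {A B : Subrepresentation ρ} :
    IsCompl A B ↔ IsCompl A.toSubmodule B.toSubmodule := by
  rw [isCompl_iff, isCompl_iff, disjoint_iff, disjoint_iff, codisjoint_iff, codisjoint_iff,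
    ← Subrepresentation.toSubmodule_injective.eq_iff,
    ← Subrepresentation.toSubmodule_injective.eq_iff]
  rfl

/-- A subrepresentation of a subrepresentation, as a subrepresentation of the whole. -/
def subOfSub {ρ : Representation k G V} (S : Subrepresentation ρ)
    (A : Subrepresentation S.toRepresentation) : Subrepresentation ρ where
  toSubmodule := A.toSubmodule.map S.toSubmodule.subtype
  apply_mem_toSubmodule g := by
    rintro _ ⟨a, ha, rfl⟩
    exact ⟨_, A.apply_mem_toSubmodule g ha, rfl⟩

theorem exists_isCompl_subOfSub {ρ : Representation k G V} {S T : Subrepresentation ρ}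
    (hST : IsCompl S T) {A B : Subrepresentation S.toRepresentation} (hAB : IsCompl A B) :
    ∃ T' : Subrepresentation ρ, IsCompl (subOfSub S A) T' := by
  refine ⟨subOfSub S B ⊔ T, ?_⟩
  rw [isCompl_toSubmodule] at hST hAB ⊢
  have h1 : (subOfSub S A).toSubmodule ⊔ (subOfSub S B).toSubmodule = S.toSubmodule := by
    change A.toSubmodule.map _ ⊔ B.toSubmodule.map _ = _
    rw [← Submodule.map_sup, hAB.sup_eq_top, Submodule.map_subtype_top]
  have h2 : Disjoint (subOfSub S A).toSubmodule (subOfSub S B).toSubmodule := by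
    change Disjoint (A.toSubmodule.map _) (B.toSubmodule.map _)
    exact (Submodule.disjoint_map (Submodule.subtype_injective _)) hAB.disjoint
  refine ⟨?_, ?_⟩
  · rw [Subrepresentation.toSubmodule_sup]
    refine h2.disjoint_sup_right_of_disjoint_sup_left ?_
    rw [h1]; exact hST.disjoint
  · rw [Subrepresentation.toSubmodule_sup, codisjoint_iff, ← sup_assoc, h1, hST.sup_eq_top]

theorem exists_isScottSummand [FiniteDimensional k V] (ρ : Representation k G V)
    (h : ρ.invariants ≠ ⊥) : ∃ S : Subrepresentation ρ, IsScottSummand ρ S := by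
  classical
  let good : Subrepresentation ρ → Prop := fun S =>
    (∃ T : Subrepresentation ρ, IsCompl S T) ∧ ∃ v ∈ S.toSubmodule, v ≠ 0 ∧ ∀ g, ρ g v = v
  have hne : ∃ n, ∃ S, good S ∧ Module.finrank k S.toSubmodule = n := by
    obtain ⟨v, hv, hv0⟩ := Submodule.exists_mem_ne_zero_of_ne_bot h
    exact ⟨_, ⊤, ⟨⟨⊥, isCompl_top_bot⟩, v, Submodule.mem_top, hv0, hv⟩, rfl⟩
  obtain ⟨S, ⟨⟨T, hT⟩, v, hvS, hv0, hv⟩, hrank⟩ := Nat.find_spec hne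
  have key : ∀ A B : Subrepresentation S.toRepresentation, IsCompl A B → ∀ a ∈ A.toSubmodule,
      a ≠ 0 → (∀ g, S.toRepresentation g a = a) → B = ⊥ := by
    intro A B hAB a haA ha0 ha
    have hA : good (subOfSub S A) := ⟨exists_isCompl_subOfSub hT hAB, a, ⟨a, haA, rfl⟩,
      fun h0 => ha0 (Subtype.ext h0), fun g => congrArg Subtype.val (ha g)⟩
    have hmin := Nat.find_min' hne ⟨_, hA, rfl⟩
    rw [← hrank] at hmin
    have e : Module.finrank k (subOfSub S A).toSubmodule = Module.finrank k A.toSubmodule :=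
      ((Submodule.equivMapOfInjective _ S.toSubmodule.injective_subtype A.toSubmodule).finrank_eq
        ).symm
    have e2 := Submodule.finrank_add_eq_of_isCompl (isCompl_toSubmodule.1 hAB)
    have hB : Module.finrank k B.toSubmodule = 0 := by omega
    exact Subrepresentation.toSubmodule_injective (Submodule.finrank_eq_zero.1 hB)
  have hv' : (⟨v, hvS⟩ : S.toSubmodule) ≠ 0 := fun h0 => hv0 (congrArg Subtype.val h0)
  have hvinv : ∀ g, S.toRepresentation g ⟨v, hvS⟩ = ⟨v, hvS⟩ := fun g => Subtype.ext (hv g)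
  refine ⟨S, ⟨T, hT⟩, ⟨⟨⟨_, _, hv'⟩⟩, fun A B hAB => ?_⟩, fun h0 => hv' ?_⟩
  · have hAB' := isCompl_toSubmodule.1 hAB
    obtain ⟨a, ha, b, hb, hab⟩ := Submodule.mem_sup.1
      (hAB'.sup_eq_top ▸ Submodule.mem_top : (⟨v, hvS⟩ : S.toSubmodule) ∈ _)
    have hfix : ∀ g, S.toRepresentation g a = a ∧ S.toRepresentation g b = b := by
      intro g
      have h1 := hvinv g
      rw [← hab, map_add] at h1
      have h2 : S.toRepresentation g a - a = b - S.toRepresentation g b := by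
        rw [sub_eq_sub_iff_add_eq_add, h1, add_comm]
      have h3 : S.toRepresentation g a - a ∈ A.toSubmodule :=
        Submodule.sub_mem _ (A.apply_mem_toSubmodule g ha) ha
      have h4 : S.toRepresentation g a - a ∈ B.toSubmodule := by
        rw [h2]; exact Submodule.sub_mem _ hb (B.apply_mem_toSubmodule g hb)
      have h5 := Submodule.disjoint_def.1 hAB'.disjoint _ h3 h4
      exact ⟨sub_eq_zero.1 h5, (sub_eq_zero.1 (h2.symm.trans h5)).symm⟩
    by_cases ha0 : a = 0
    · left
      refine key B A hAB.symm b hb (fun hb0 => hv' ?_) (fun g => (hfix g).2)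
      rw [← hab, ha0, hb0, add_zero]
    · exact Or.inr (key A B hAB a ha ha0 fun g => (hfix g).1)
  · have : (⟨v, hvS⟩ : S.toSubmodule) ∈ S.toRepresentation.invariants := hvinv
    rw [h0] at this
    exact (Submodule.mem_bot k).1 this

end Indecomposable

section Scott

variable (k : Type*) [Field k] {G : Type*} [Group G] (H : Subgroup G)

/-- The induced module `Ind_H^G(k)` of the trivial `kH`-module `k`. -/
noncomputable abbrev indTrivial : Representation k G (IndV H.subtype (trivial k H k)) :=
  ind H.subtype (trivial k H k)

theorem indTrivial_invariants_ne_bot [Finite G] : (indTrivial k H).invariants ≠ ⊥ := by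
  classical
  have := Fintype.ofFinite G
  have := Fintype.ofFinite (Quotient (QuotientGroup.rightRel H))
  -- the vector attached to a right coset of `H`
  have hmk : ∀ (h : H) (g : G), IndV.mk H.subtype (trivial k H k) (h * g) 1 =
      IndV.mk H.subtype (trivial k H k) g 1 := by
    intro h g
    have := Coinvariants.mk_self_apply
      (Representation.tprod ((leftRegular k G).comp H.subtype) (trivial k H k)) h
      (TensorProduct.tmul k (MonoidAlgebra.single g 1) 1)
    simpa using this
  let f : Quotient (QuotientGroup.rightRel H) → IndV H.subtype (trivial k H k) :=
    Quotient.lift (fun g => IndV.mk H.subtype (trivial k H k) g 1) (by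
      intro a b hab
      have hab' := QuotientGroup.rightRel_apply.1 hab
      have := hmk ⟨_, hab'⟩ a
      simpa using this.symm)
  have hf : ∀ g : G, f (Quotient.mk _ g) = IndV.mk H.subtype (trivial k H k) g 1 := fun _ => rfl
  -- the linear functional `g ⊗ a ↦ a` if `g ∈ H`, and `0` otherwise
  let L : MonoidAlgebra k G →ₗ[k] k :=
    (Finsupp.lsum k fun g : G => if g ∈ H then LinearMap.id else 0) ∘ₗ
      (MonoidAlgebra.coeffLinearEquiv k).toLinearMap
  have hL : ∀ g : G, L (MonoidAlgebra.single g 1) = if g ∈ H then 1 else 0 := by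
    intro g
    by_cases hg : g ∈ H <;> simp [L, hg]
  let F : IndV H.subtype (trivial k H k) →ₗ[k] k :=
    Coinvariants.lift _ ((_root_.TensorProduct.rid k k).toLinearMap ∘ₗ L.rTensor k) (by
      intro h
      ext g
      simp [hL, Subgroup.mul_mem_cancel_left])
  have hF : ∀ g : G, F (IndV.mk H.subtype (trivial k H k) g 1) = if g ∈ H then 1 else 0 := by
    intro g
    simp [F, hL]
  let v := ∑ c, f c
  have hv : v ∈ (indTrivial k H).invariants := by
    intro g
    let e : Quotient (QuotientGroup.rightRel H) ≃ Quotient (QuotientGroup.rightRel H) :=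
      Quotient.congr (Equiv.mulRight g⁻¹) (by
        intro a b
        rw [QuotientGroup.rightRel_apply, QuotientGroup.rightRel_apply]
        simp)
    simp only [v, map_sum]
    refine Fintype.sum_equiv e _ _ fun c => ?_
    induction c using Quotient.inductionOn with
    | h a => exact ind_mk _ _ _ _ _
  have hFv : F v = 1 := by
    simp only [v, map_sum]
    rw [Finset.sum_eq_single (Quotient.mk _ 1)]
    · rw [hf, hF, if_pos H.one_mem]
    · intro c _ hc
      induction c using Quotient.inductionOn with
      | h a =>
        rw [hf, hF, if_neg]
        intro ha
        refine hc (Quotient.sound ?_)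
        rw [← Quotient.eq_iff_equiv, Quotient.eq, QuotientGroup.rightRel_apply]
        simpa using ha
    · simp
  intro hbot
  rw [hbot, Submodule.mem_bot] at hv
  rw [hv, map_zero] at hFv
  exact zero_ne_one hFv

theorem exists_scottModule [Finite G] :
    ∃ S : Subrepresentation (indTrivial k H), IsScottSummand (indTrivial k H) S :=
  haveI : Module.Finite k (MonoidAlgebra k G) :=
    Module.Finite.equiv (MonoidAlgebra.coeffLinearEquiv k).symm
  exists_isScottSummand _ (indTrivial_invariants_ne_bot k H)

/-- The Scott module `S(G, H)`: the (up to isomorphism unique) indecomposable direct summand of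
`Ind_H^G(k)` whose socle contains the trivial module. -/
noncomputable def scottModule [Finite G] : Subrepresentation (indTrivial k H) :=
  (exists_scottModule k H).choose

/-- The action of `G` on the Scott module `S(G, H)`. -/
noncomputable abbrev scottRep [Finite G] :
    Representation k G (scottModule k H).toSubmodule :=
  (scottModule k H).toRepresentation

end Scott

section Brauer

variable {k G V : Type*} [Field k] [Group G] [AddCommGroup V] [Module k V]
  (ρ : Representation k G V)

/-- The fixed points `V^Q`. -/
noncomputable def fixedBy (Q : Subgroup G) : Submodule k V :=
  invariants (ρ.comp Q.subtype)

/-- The image `V_R^Q` of the relative trace `V^R → V^Q`, `m ↦ ∑_{x ∈ [Q/R]} x m`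
(meant for `R ≤ Q`, where the sum does not depend on the choice of coset representatives). -/
noncomputable def relTraceImage (R Q : Subgroup G) : Submodule k V :=
  (fixedBy ρ R).map (∑ᶠ x : Q ⧸ R.subgroupOf Q, ρ (x.out : G))

/-- `∑_{R < Q} V_R^Q`. -/
noncomputable def brauerKer (Q : Subgroup G) : Submodule k V :=
  ⨆ (R : Subgroup G) (_ : R < Q), relTraceImage ρ R Q

theorem apply_mem_fixedBy {Q : Subgroup G} {n : G} (hn : n ∈ Subgroup.normalizer (Q : Set G))
    {v : V} (hv : v ∈ fixedBy ρ Q) : ρ n v ∈ fixedBy ρ Q := by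
  intro q
  have h := hv ⟨_, (Subgroup.mem_normalizer_iff''.1 hn q).1 q.2⟩
  change ρ (n⁻¹ * q * n) v = v at h
  change ρ q (ρ n v) = ρ n v
  conv_rhs => rw [← h]
  rw [← Module.End.mul_apply, ← Module.End.mul_apply, ← map_mul, ← map_mul]
  congr 2; group

theorem apply_mem_relTraceImage [Finite G] {Q R : Subgroup G} (hR : R < Q) {n : G}
    (hn : n ∈ Subgroup.normalizer (Q : Set G)) {v : V} (hv : v ∈ relTraceImage ρ R Q) :
    ρ n v ∈ brauerKer ρ Q := by
  classical
  have := Fintype.ofFinite (Q ⧸ R.subgroupOf Q)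
  obtain ⟨m, hm, rfl⟩ := hv
  -- conjugation by `n`, as an automorphism of `Q`
  have hnq : ∀ q : G, q ∈ Q ↔ n * q * n⁻¹ ∈ Q := Subgroup.mem_normalizer_iff.1 hn
  let e : Q ≃ Q :=
    { toFun := fun q => ⟨n * q * n⁻¹, (hnq q).1 q.2⟩
      invFun := fun q => ⟨n⁻¹ * q * n, (Subgroup.mem_normalizer_iff''.1 hn q).1 q.2⟩
      left_inv := fun q => Subtype.ext (by simp only []; group)
      right_inv := fun q => Subtype.ext (by simp only []; group) }
  let R' : Subgroup G := R.map (MulAut.conj n).toMonoidHom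
  have hR'mem : ∀ x : G, n * x * n⁻¹ ∈ R' ↔ x ∈ R := by
    intro x
    constructor
    · rintro ⟨y, hy, hxy⟩
      have : y = x := by simpa using hxy
      exact this ▸ hy
    · intro hx
      exact ⟨x, hx, by simp⟩
  have hR' : R' < Q := by
    refine lt_of_le_of_ne ?_ ?_
    · rintro _ ⟨y, hy, rfl⟩
      exact (hnq y).1 (hR.le hy)
    · intro h
      refine hR.ne (le_antisymm hR.le fun x hx => ?_)
      rw [← hR'mem, h]
      exact (hnq x).1 hx
  have := Fintype.ofFinite (Q ⧸ R'.subgroupOf Q)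
  have hm' : ρ n m ∈ fixedBy ρ R' := by
    rintro ⟨_, ⟨y, hy, rfl⟩⟩
    have h : ρ y m = m := hm ⟨y, hy⟩
    change ρ (n * y * n⁻¹) (ρ n m) = ρ n m
    rw [← Module.End.mul_apply, ← map_mul, inv_mul_cancel_right, map_mul, Module.End.mul_apply, h]
  -- the summands do not depend on the coset representative
  have hrep : ∀ (T : Subgroup G) (w : V), w ∈ fixedBy ρ T → ∀ q : Q,
      ρ (((q : Q ⧸ T.subgroupOf Q).out : Q) : G) w = ρ q w := by
    intro T w hw q
    obtain ⟨t, ht⟩ := QuotientGroup.mk_out_eq_mul (T.subgroupOf Q) q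
    have h : ρ ((t : Q) : G) w = w := hw ⟨_, t.2⟩
    rw [ht, Subgroup.coe_mul, map_mul, Module.End.mul_apply, h]
  let E : (Q ⧸ R.subgroupOf Q) ≃ (Q ⧸ R'.subgroupOf Q) := Quotient.congr e (by
    intro a b
    rw [QuotientGroup.leftRel_apply, QuotientGroup.leftRel_apply, Subgroup.mem_subgroupOf, Subgroup.mem_subgroupOf,
      ← hR'mem]
    have : n * ((a⁻¹ * b : Q) : G) * n⁻¹ = (((e a)⁻¹ * e b : Q) : G) := by
      simp only [e, Equiv.coe_fn_mk, Subgroup.coe_mul, Subgroup.coe_inv]; group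
    rw [this])
  have hmem : (∑ᶠ x : Q ⧸ R'.subgroupOf Q, ρ (x.out : G)) (ρ n m) ∈ relTraceImage ρ R' Q :=
    ⟨_, hm', rfl⟩
  have heq : ρ n ((∑ᶠ x : Q ⧸ R.subgroupOf Q, ρ (x.out : G)) m) =
      (∑ᶠ x : Q ⧸ R'.subgroupOf Q, ρ (x.out : G)) (ρ n m) := by
    rw [finsum_eq_sum_of_fintype, finsum_eq_sum_of_fintype, LinearMap.sum_apply,
      LinearMap.sum_apply, map_sum]
    refine Fintype.sum_equiv E _ _ fun x => ?_
    induction x using QuotientGroup.induction_on with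
    | H q =>
      change _ = ρ (((e q : Q ⧸ R'.subgroupOf Q).out : Q) : G) (ρ n m)
      rw [hrep R m hm q, hrep R' _ hm' (e q), ← Module.End.mul_apply, ← Module.End.mul_apply,
        ← map_mul, ← map_mul]
      simp [e]
  rw [heq]
  exact (le_iSup₂_of_le (f := fun (R : Subgroup G) (_ : R < Q) => relTraceImage ρ R Q)
    R' hR' le_rfl) hmem

theorem apply_mem_brauerKer [Finite G] {Q : Subgroup G} {n : G}
    (hn : n ∈ Subgroup.normalizer (Q : Set G)) {v : V} (hv : v ∈ brauerKer ρ Q) :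
    ρ n v ∈ brauerKer ρ Q := by
  have : brauerKer ρ Q ≤ (brauerKer ρ Q).comap (ρ n) :=
    iSup₂_le fun R hR v hv => apply_mem_relTraceImage ρ hR hn hv
  exact this hv

/-- The underlying space `V(Q) = V^Q / ∑_{R < Q} V_R^Q` of the Brauer construction. -/
abbrev BrauerQuotient (Q : Subgroup G) : Type _ :=
  fixedBy ρ Q ⧸ (brauerKer ρ Q).submoduleOf (fixedBy ρ Q)

/-- The Brauer construction `V(Q)`, as a representation of `N_G(Q)`. -/
noncomputable def brauer [Finite G] (Q : Subgroup G) :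
    Representation k (Subgroup.normalizer (Q : Set G)) (BrauerQuotient ρ Q) :=
  quotient
    (subrepresentation (ρ.comp (Subgroup.normalizer (Q : Set G)).subtype) (fixedBy ρ Q)
      (fun n _ hv => apply_mem_fixedBy ρ n.2 hv))
    ((brauerKer ρ Q).submoduleOf (fixedBy ρ Q))
    (fun n _ hv => apply_mem_brauerKer ρ n.2 hv)

end Brauer

section BrauerIndecomposable

variable {k G V W : Type*} [Field k] [Group G] [AddCommGroup V] [Module k V]
  [AddCommGroup W] [Module k W]

theorem mul_centralizer_le_normalizer (Q : Subgroup G) :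
    Q ⊔ Subgroup.centralizer (Q : Set G) ≤ Subgroup.normalizer (Q : Set G) :=
  sup_le Subgroup.le_normalizer (by
    intro c hc
    rw [Subgroup.mem_normalizer_iff]
    intro q
    have hc' := Subgroup.mem_centralizer_iff.1 hc
    constructor
    · intro hq
      rw [← hc' q hq]; simpa using hq
    · intro hq
      have h := hc' _ hq
      have : c * q * c⁻¹ = q := by
        have h2 : c * (q * c⁻¹ * c) = c * (c * q * c⁻¹) := by rw [← h]; group
        have h3 := mul_left_cancel h2
        rw [← h3]; group
      rwa [this] at hq)

/-- The restriction `Res^{N_G(Q)}_{Q C_G(Q)}`. -/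
def resQC (Q : Subgroup G) (σ : Representation k (Subgroup.normalizer (Q : Set G)) W) :
    Representation k ↥(Q ⊔ Subgroup.centralizer (Q : Set G)) W :=
  σ.comp (Subgroup.inclusion (mul_centralizer_le_normalizer Q))

/-- `V` is Brauer indecomposable: for every `p`-subgroup `Q` of `G`, the restriction of `V(Q)` to
`Q C_G(Q)` is indecomposable or zero. -/
def IsBrauerIndecomposable [Finite G] (p : ℕ) (ρ : Representation k G V) : Prop :=
  ∀ Q : Subgroup G, IsPGroup p Q →
    (resQC Q (brauer ρ Q)).IsIndecomposable ∨ Subsingleton (BrauerQuotient ρ Q)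

end BrauerIndecomposable

end Representation

/-! Everything takes place in the permutation module on `X = G ⧸ P`. Its endomorphisms are the
invariant matrices, direct summands correspond to idempotents, and indecomposable summands to
primitive ones (`IsRealizedBy.isIndecomposable_iff`). `S(G,P)` becomes a primitive idempotent `e`
with row sums 1. Since the stabilizer of the base point in `N_G(Q)` is `N_P(Q)`, the module
`S(N_G(Q), N_P(Q))` becomes an idempotent `f Q` on the same set, supported on the orbit of the base
point (`exists_isScottIdempotent`). The Brauer construction turns into `br Q`, restriction of a
matrix to the `Q`-fixed points, which is multiplicative in characteristic `p` (`br_mul`,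
`IsRealizedBy.exists_brauer`).

Saturation enters once: if `Q` is fully normalized, the stabilizer in `N_G(Q)` of any `Q`-fixed
point is conjugate into `N_P(Q)`. Hence `f Q` is equivalent to a summand of `br Q e`
(`exists_scott_summand`). If `br Q e` is primitive under `Q C_G(Q)`, that summand is all of it, so
(1) implies (2).

For the converse, descend on the order of `Q`. Enlarging `Q` by the core does not change its fixed
points; without fixed points `br Q e` is zero; otherwise `Q` is conjugate to a fully normalized
subgroup of `P` of the same order, so let `Q` be fully normalized. Split `br Q e = e₁ + e₂` with
`e₁` equivalent to `f Q`. For a larger `p`-subgroup `R` of `N_G(Q)` with a fixed point, `br R e₁` is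
nonzero and `br R e` is primitive by induction, so `br R e₂ = 0`. Thus `e₂` lives on pairs of points
whose joint stabilizer is exactly `Q`, and such a matrix lifts to a `G`-invariant one
(`exists_br_eq`). If `e₂` were nonzero, locality of the corner ring of `e` would make the lift
invertible there and force `e₁ = 0`. So `br Q e` is equivalent to `f Q` (`mul_eq_br_of_forall_lt`),
and (2) gives its primitivity. -/

/-! ### Fitting idempotents in finite-dimensional algebras. -/

section FiniteDimensionalAlgebra

variable {k A : Type*} [Field k] [Ring A] [Algebra k A]

open Polynomial in
/-- In a finite-dimensional algebra, every element `a` has a multiple `a * u` by a polynomial `u`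
in `a` which is idempotent, and which vanishes only if `a` is nilpotent. -/
theorem exists_mem_adjoin_isIdempotentElem_mul [FiniteDimensional k A] (a : A) :
    ∃ u ∈ Algebra.adjoin k {a}, IsIdempotentElem (a * u) ∧ (a * u = 0 → IsNilpotent a) := by
  have hint : IsIntegral k a := IsIntegral.of_finite k a
  have hne : minpoly k a ≠ 0 := minpoly.ne_zero hint
  obtain ⟨q, hq, hqX⟩ := exists_eq_pow_rootMultiplicity_mul_and_not_dvd (minpoly k a) hne 0
  set n := (minpoly k a).rootMultiplicity 0
  rw [map_zero, sub_zero] at hq hqX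
  -- The minimal polynomial is `X ^ n * q` with `X` not dividing `q`. The exponent `n + 1` leaves a
  -- factor `a` to split off even when `n = 0`; the first term of the Bézout identity, evaluated at
  -- `a`, is the Fitting idempotent.
  have hcop : IsCoprime ((X : k[X]) ^ (n + 1)) q :=
    (((irreducible_X (R := k)).coprime_iff_not_dvd).2 hqX).pow_left
  obtain ⟨r, s, hrs⟩ := hcop
  have hmem : ∀ f : k[X], aeval a f ∈ Algebra.adjoin k {a} := fun f =>
    aeval_mem_adjoin_singleton k a
  have h0 : a ^ (n + 1) * aeval a q = 0 := by
    have := minpoly.aeval k a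
    rw [hq, map_mul, map_pow, aeval_X] at this
    rw [pow_succ', mul_assoc, this, mul_zero]
  have h1 : aeval a r * a ^ (n + 1) + aeval a s * aeval a q = 1 := by
    have := congrArg (aeval a) hrs
    simpa using this
  have hcr : Commute a (aeval a r) := by
    have := (Commute.all (X : k[X]) r).map (aeval a)
    rwa [aeval_X] at this
  have hcs : Commute a (aeval a s) := by
    have := (Commute.all (X : k[X]) s).map (aeval a)
    rwa [aeval_X] at this
  have hrs' : Commute (aeval a r) (aeval a s) := (Commute.all r s).map (aeval a)
  have hu : a * (a ^ n * aeval a r) = aeval a r * a ^ (n + 1) := by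
    rw [← mul_assoc, ← pow_succ', (hcr.pow_left (n + 1)).eq]
  refine ⟨a ^ n * aeval a r, Subalgebra.mul_mem _
    (Subalgebra.pow_mem _ (Algebra.self_mem_adjoin_singleton k a) n) (hmem r), ?_, ?_⟩
  · rw [hu]
    set f := aeval a r * a ^ (n + 1) with hf
    have h2 : f * (aeval a s * aeval a q) = 0 := by
      rw [hf, mul_assoc, ← mul_assoc (a ^ (n + 1)), (hcs.pow_left (n + 1)).eq, mul_assoc, h0,
        mul_zero, mul_zero]
    have h3 : f * (f + aeval a s * aeval a q) = f * 1 := by rw [h1]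
    rwa [mul_add, h2, add_zero, mul_one] at h3
  · intro h
    rw [hu] at h
    rw [h, zero_add] at h1
    refine ⟨n + 1, ?_⟩
    rw [← mul_one (a ^ (n + 1)), ← h1, ← mul_assoc, (hcs.pow_left (n + 1)).eq, mul_assoc, h0,
      mul_zero]

end FiniteDimensionalAlgebra

/-! ### Matrices that are invariant under a permutation action -/

namespace PermMatrix

open Matrix MulAction

variable {k X : Type*} [Field k] [Fintype X] [DecidableEq X]

section Invariant

variable (N : Type*) [Group N] [MulAction N X]

variable (k X) in
/-- The algebra of the endomorphisms of the permutation module `k^X`, as invariant matrices. -/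
def invariantSubalgebra : Subalgebra k (Matrix X X k) where
  carrier := {a | ∀ (n : N) (x y : X), a (n • x) (n • y) = a x y}
  mul_mem' := by
    intro a b ha hb n x y
    simp only [mul_apply]
    rw [← Equiv.sum_comp (MulAction.toPerm n)]
    exact Finset.sum_congr rfl fun z _ => by simp only [toPerm_apply, ha n, hb n]
  add_mem' := by
    intro a b ha hb n x y
    simp only [Matrix.add_apply, ha n, hb n]
  algebraMap_mem' := by
    intro r n x y
    simp [algebraMap_matrix_apply]

/-- `e` is a primitive idempotent of the algebra of the invariant matrices. -/
structure IsPrimitive (e : Matrix X X k) : Prop where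
  ne_zero : e ≠ 0
  idem : e * e = e
  mem : e ∈ invariantSubalgebra k X N
  eq_zero_or_eq : ∀ f ∈ invariantSubalgebra k X N, f * f = f → e * f = f → f * e = f →
    f = 0 ∨ f = e

variable {N}

/-- The corner ring of a primitive idempotent is local. -/
theorem IsPrimitive.exists_mul_eq {e a : Matrix X X k} (he : IsPrimitive N e)
    (ha : a ∈ invariantSubalgebra k X N) (hea : e * a = a) (hae : a * e = a)
    (hnil : ¬ IsNilpotent a) :
    ∃ c ∈ invariantSubalgebra k X N, e * c = c ∧ c * e = c ∧ a * c = e := by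
  obtain ⟨u, hu, hidem, hz⟩ := exists_mem_adjoin_isIdempotentElem_mul (k := k) a
  have humem : u ∈ invariantSubalgebra k X N :=
    Algebra.adjoin_le (S := invariantSubalgebra k X N) (by simpa using ha) hu
  have hcomm : a * u = u * a := (Algebra.commute_of_mem_adjoin_self hu).eq
  have h1 : e * (a * u) = a * u := by rw [← mul_assoc, hea]
  have h2 : a * u * e = a * u := by rw [hcomm, mul_assoc, hae]
  rcases he.eq_zero_or_eq _ (Subalgebra.mul_mem _ ha humem) hidem h1 h2 with h | h
  · exact absurd (hz h) hnil
  -- A polynomial in `a` need not lie in the corner of `e`, because of its constant term, so `u` is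
  -- cut down on both sides.
  · refine ⟨e * u * e, Subalgebra.mul_mem _ (Subalgebra.mul_mem _ he.mem humem) he.mem, ?_, ?_, ?_⟩
    · rw [← mul_assoc, ← mul_assoc, he.idem]
    · rw [mul_assoc, he.idem]
    · rw [← mul_assoc, ← mul_assoc, hae, h, he.idem]

/-- Primitivity is invariant under the equivalence of idempotents. -/
theorem IsPrimitive.of_equiv {e f a b : Matrix X X k} (he : IsPrimitive N e)
    (ha : a ∈ invariantSubalgebra k X N) (hb : b ∈ invariantSubalgebra k X N)
    (hab : a * b = f) (hba : b * a = e) (hae : a * e = a) (heb : e * b = b) :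
    IsPrimitive N f := by
  have hidem : f * f = f := by
    rw [← hab, mul_assoc, ← mul_assoc b, hba, heb]
  have hfa : f * a = a := by rw [← hab, mul_assoc, hba, hae]
  have hbf : b * f = b := by rw [← hab, ← mul_assoc, hba, heb]
  refine ⟨?_, hidem, hab ▸ Subalgebra.mul_mem _ ha hb, ?_⟩
  · rintro rfl
    refine he.ne_zero ?_
    rw [← he.idem, ← hba, mul_assoc, ← mul_assoc a, hab, zero_mul, mul_zero]
  · intro g hg hgg hfg hgf
    -- Idempotents below `f` are carried to idempotents below `e` by `g ↦ b * g * a`, with inverse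
    -- `h ↦ a * h * b`.
    have key : a * (b * g * a) * b = g := by
      rw [← mul_assoc, ← mul_assoc, hab, mul_assoc, hab, hfg, hgf]
    have h := he.eq_zero_or_eq (b * g * a)
      (Subalgebra.mul_mem _ (Subalgebra.mul_mem _ hb hg) ha)
      (by rw [show b * g * a * (b * g * a) = b * (g * (a * b) * g) * a by simp only [mul_assoc],
            hab, hgf, hgg])
      (by rw [← mul_assoc, ← mul_assoc, heb])
      (by rw [mul_assoc, hae])
    rcases h with h | h
    · left; rw [← key, h, mul_zero, zero_mul]
    · right; rw [← key, h, hae, hab]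

end Invariant

end PermMatrix

/-! ### The Brauer map on invariant matrices. -/

namespace PermMatrix

open Matrix MulAction

variable {k X : Type*} [Field k]

section SumFixed

variable {N : Type*} [Group N] [MulAction N X] [Fintype X]

/-- In characteristic `p`, summing an invariant function of a `p`-group action only sees the fixed
points. -/
theorem sum_fixedPoints_eq_sum [DecidablePred (· ∈ fixedPoints N X)] (p : ℕ) [Fact p.Prime]
    [CharP k p] (hN : IsPGroup p N) (φ : X → k) (hφ : ∀ (n : N) x, φ (n • x) = φ x) :
    ∑ x with x ∈ fixedPoints N X, φ x = ∑ x, φ x := by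
  classical
  have hmaps : ∀ s : Finset X, ∀ x ∈ s, φ x ∈ Finset.univ.image φ := fun s x _ =>
    Finset.mem_image_of_mem _ (Finset.mem_univ x)
  -- Compare level set by level set: each level set of `φ` is stable under `N`, so its cardinality
  -- agrees modulo `p` with that of its fixed points.
  rw [← Finset.sum_fiberwise_of_maps_to (hmaps _), ← Finset.sum_fiberwise_of_maps_to (hmaps _)]
  refine Finset.sum_congr rfl fun c _ => ?_
  have hconst : ∀ s : Finset X, ∑ x ∈ s with φ x = c, φ x = ((s.filter (φ · = c)).card : k) * c := by
    intro s
    rw [Finset.sum_congr rfl (fun x hx => (Finset.mem_filter.1 hx).2), Finset.sum_const,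
      nsmul_eq_mul]
  rw [hconst, hconst]
  congr 1
  let S : SubMulAction N X :=
    { carrier := {x | φ x = c}
      smul_mem' := fun n x hx => (hφ n x).trans hx }
  have h := hN.card_modEq_card_fixedPoints S
  have h1 : Nat.card S = (Finset.univ.filter (φ · = c)).card := by
    change Nat.card {x // φ x = c} = _
    rw [Nat.card_eq_fintype_card, Fintype.card_subtype]
  have h2 : Nat.card (fixedPoints N S) =
      ((Finset.univ.filter (· ∈ fixedPoints N X)).filter (φ · = c)).card := by
    rw [← Fintype.card_coe, ← Nat.card_eq_fintype_card]
    refine Nat.card_congr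
      { toFun := fun x => ⟨x.1.1, Finset.mem_filter.2 ⟨Finset.mem_filter.2 ⟨Finset.mem_univ _,
          fun n => congrArg Subtype.val (x.2 n)⟩, x.1.2⟩⟩
        invFun := fun x => ⟨⟨x.1, (Finset.mem_filter.1 x.2).2⟩, fun n => Subtype.ext
          ((Finset.mem_filter.1 (Finset.mem_filter.1 x.2).1).2 n)⟩
        left_inv := fun _ => rfl
        right_inv := fun _ => rfl }
  rw [h1, h2] at h
  exact (CharP.natCast_eq_natCast' k p h).symm

end SumFixed

section BrauerMap

variable {G : Type*} [Group G] [MulAction G X]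

open scoped Classical in
/-- The restriction of a matrix to the fixed points of `Q`, extended by zero. -/
noncomputable def br (Q : Subgroup G) (a : Matrix X X k) : Matrix X X k := fun x y =>
  if Q ≤ stabilizer G x ∧ Q ≤ stabilizer G y then a x y else 0

theorem br_apply {Q : Subgroup G} (a : Matrix X X k) {x y : X} (hx : Q ≤ stabilizer G x)
    (hy : Q ≤ stabilizer G y) : br Q a x y = a x y := if_pos ⟨hx, hy⟩

theorem br_apply_left {Q : Subgroup G} (a : Matrix X X k) {x : X} (y : X)
    (hx : ¬ Q ≤ stabilizer G x) : br Q a x y = 0 := if_neg fun h => hx h.1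

theorem br_apply_right {Q : Subgroup G} (a : Matrix X X k) (x : X) {y : X}
    (hy : ¬ Q ≤ stabilizer G y) : br Q a x y = 0 := if_neg fun h => hy h.2

theorem br_add (Q : Subgroup G) (a b : Matrix X X k) : br Q (a + b) = br Q a + br Q b := by
  ext x y
  simp only [br, Matrix.add_apply]
  split_ifs <;> simp

theorem br_zero (Q : Subgroup G) : br Q (0 : Matrix X X k) = 0 := by
  ext x y
  simp [br]

theorem br_br {Q R : Subgroup G} (h : Q ≤ R) (a : Matrix X X k) : br R (br Q a) = br R a := by
  ext x y
  by_cases hx : R ≤ stabilizer G x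
  · by_cases hy : R ≤ stabilizer G y
    · rw [br_apply _ hx hy, br_apply _ hx hy, br_apply _ (h.trans hx) (h.trans hy)]
    · rw [br_apply_right _ _ hy, br_apply_right _ _ hy]
  · rw [br_apply_left _ _ hx, br_apply_left _ _ hx]

/-- A subgroup acting trivially does not change the fixed points; it is applied to the normal core
of `P`. -/
theorem br_sup_eq {Q C : Subgroup G} (hC : ∀ x : X, C ≤ stabilizer G x) (e : Matrix X X k) :
    br (Q ⊔ C) e = br Q e := by
  have key : ∀ x : X, Q ⊔ C ≤ stabilizer G x ↔ Q ≤ stabilizer G x := fun x =>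
    ⟨le_sup_left.trans, fun h => sup_le h (hC x)⟩
  classical
  ext x y
  exact if_congr (and_congr (key x) (key y)) rfl rfl

/-- The fixed points of `Q` are permuted by the normalizer of `Q`. -/
theorem le_stabilizer_smul_iff {Q : Subgroup G} {n : G}
    (hn : n ∈ Subgroup.normalizer (Q : Set G)) (x : X) :
    Q ≤ stabilizer G (n • x) ↔ Q ≤ stabilizer G x := by
  have key : ∀ m ∈ Subgroup.normalizer (Q : Set G), ∀ x : X, Q ≤ stabilizer G x →
      Q ≤ stabilizer G (m • x) := by
    intro m hm x hx q hq
    have h : (m⁻¹ * q * m) • x = x := hx ((Subgroup.mem_normalizer_iff''.1 hm q).1 hq)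
    rw [mem_stabilizer_iff, ← mul_smul, ← inv_smul_eq_iff, ← mul_smul, ← mul_assoc, h]
  refine ⟨fun h => ?_, key n hn x⟩
  have := key n⁻¹ (Subgroup.inv_mem _ hn) _ h
  rwa [inv_smul_smul] at this

variable [Fintype X]

open scoped Classical in
theorem sum_le_stabilizer_eq_sum (p : ℕ) [Fact p.Prime] [CharP k p] {Q : Subgroup G}
    (hQ : IsPGroup p Q) (φ : X → k)
    (hφ : ∀ q ∈ Q, ∀ x, φ (q • x) = φ x) :
    ∑ x with Q ≤ stabilizer G x, φ x = ∑ x, φ x := by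
  rw [← sum_fixedPoints_eq_sum p hQ φ (fun q x => hφ q q.2 x)]
  refine Finset.sum_congr ?_ fun _ _ => rfl
  ext x
  simp only [Finset.mem_filter, Finset.mem_univ, true_and, mem_fixedPoints]
  exact ⟨fun h q => h q.2, fun h q hq => h ⟨q, hq⟩⟩

variable [DecidableEq X]

theorem br_mem_invariantSubalgebra {Q H : Subgroup G} (hH : H ≤ Subgroup.normalizer (Q : Set G))
    {a : Matrix X X k} (ha : a ∈ invariantSubalgebra k X H) :
    br Q a ∈ invariantSubalgebra k X H := by
  intro n x y
  simp only [br]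
  have hn := hH n.2
  have h1 : Q ≤ stabilizer G (n • x) ↔ _ := le_stabilizer_smul_iff hn x
  have h2 : Q ≤ stabilizer G (n • y) ↔ _ := le_stabilizer_smul_iff hn y
  rw [h1, h2, ha n]

theorem invariantSubalgebra_mono {H K : Subgroup G} (h : H ≤ K) :
    invariantSubalgebra k X K ≤ invariantSubalgebra k X H :=
  fun _ ha n x y => ha ⟨n, h n.2⟩ x y

theorem invariantSubalgebra_le (H : Subgroup G) :
    invariantSubalgebra k X G ≤ invariantSubalgebra k X H :=
  fun _ ha n x y => ha n x y

variable (p : ℕ) [Fact p.Prime] [CharP k p]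

/-- The Brauer map is multiplicative. -/
theorem br_mul {Q : Subgroup G} (hQ : IsPGroup p Q) {a b : Matrix X X k}
    (ha : a ∈ invariantSubalgebra k X Q) (hb : b ∈ invariantSubalgebra k X Q) :
    br Q (a * b) = br Q a * br Q b := by
  classical
  ext x z
  rw [mul_apply]
  by_cases hx : Q ≤ stabilizer G x
  · by_cases hz : Q ≤ stabilizer G z
    -- For fixed points `x` and `z`, the summand `a x y * b y z` is a `Q`-invariant function of `y`,
    -- so the non-fixed `y` contribute zero in total.
    · rw [br_apply _ hx hz, mul_apply, ← sum_le_stabilizer_eq_sum p hQ, Finset.sum_filter]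
      · refine Finset.sum_congr rfl fun y _ => ?_
        split_ifs with hy
        · rw [br_apply _ hx hy, br_apply _ hy hz]
        · rw [br_apply_right _ _ hy, zero_mul]
      · intro q hq y
        have hqx : q • x = x := hx hq
        have hqz : q • z = z := hz hq
        have h1 : a (q • x) (q • y) = a x y := ha ⟨q, hq⟩ x y
        have h2 : b (q • y) (q • z) = b y z := hb ⟨q, hq⟩ y z
        rw [hqx] at h1
        rw [hqz] at h2
        rw [h1, h2]
    · rw [br_apply_right _ _ hz]
      exact (Finset.sum_eq_zero fun y _ => by rw [br_apply_right _ _ hz, mul_zero]).symm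
  · rw [br_apply_left _ _ hx]
    exact (Finset.sum_eq_zero fun y _ => by rw [br_apply_left _ _ hx, zero_mul]).symm

end BrauerMap

end PermMatrix

/-! ### Saturated fusion systems -/

namespace Fusion

variable {G : Type*} [Group G]

/-- Conjugation with `g`, as an isomorphism `S ≃* R`. -/
def conjEquiv {S R : Subgroup G} (g : G) (h : ∀ s, s ∈ S ↔ g * s * g⁻¹ ∈ R) : S ≃* R where
  toFun s := ⟨g * s * g⁻¹, (h s).1 s.2⟩
  invFun r := ⟨g⁻¹ * r * g, (h _).2 (by
    rw [show g * (g⁻¹ * r * g) * g⁻¹ = (r : G) by group]; exact r.2)⟩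
  left_inv s := Subtype.ext (by simp only []; group)
  right_inv r := Subtype.ext (by simp only []; group)
  map_mul' s t := Subtype.ext (by simp only [Subgroup.coe_mul]; group)

theorem coe_conjEquiv {S R : Subgroup G} (g : G) (h : ∀ s, s ∈ S ↔ g * s * g⁻¹ ∈ R) (s : S) :
    (conjEquiv g h s : G) = g * s * g⁻¹ := rfl

theorem mem_iff_conj_mem_of_equiv {S R : Subgroup G} (φ : S ≃* R) {g : G}
    (h : ∀ s : S, (φ s : G) = g * s * g⁻¹) (s : G) : s ∈ S ↔ g * s * g⁻¹ ∈ R := by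
  constructor
  · intro hs
    rw [← h ⟨s, hs⟩]
    exact (φ ⟨s, hs⟩).2
  · intro hs
    have h1 := h (φ.symm ⟨_, hs⟩)
    rw [MulEquiv.apply_symm_apply] at h1
    have h2 : s = φ.symm ⟨_, hs⟩ := mul_left_cancel (mul_right_cancel h1)
    rw [h2]
    exact (φ.symm ⟨_, hs⟩).2

theorem areConj_iff {S R : Subgroup G} :
    AreConj S R ↔ ∃ g : G, ∀ s, s ∈ S ↔ g * s * g⁻¹ ∈ R := by
  constructor
  · rintro ⟨φ, g, hg⟩
    exact ⟨g, mem_iff_conj_mem_of_equiv φ hg⟩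
  · rintro ⟨g, hg⟩
    exact ⟨conjEquiv g hg, g, fun _ => rfl⟩

theorem conj_mem_normalizer {S R : Subgroup G} {g : G} (h : ∀ s, s ∈ S ↔ g * s * g⁻¹ ∈ R)
    {m : G} (hm : m ∈ Subgroup.normalizer (S : Set G)) :
    g * m * g⁻¹ ∈ Subgroup.normalizer (R : Set G) := by
  have h' : ∀ r, r ∈ R ↔ g⁻¹ * r * g ∈ S := fun r => by
    rw [h, show g * (g⁻¹ * r * g) * g⁻¹ = r by group]
  rw [Subgroup.mem_normalizer_iff] at hm ⊢
  intro r
  rw [h', hm, h' (g * m * g⁻¹ * r * (g * m * g⁻¹)⁻¹)]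
  congr! 1
  group

theorem exists_isFullyNormalized [Finite G] {P Q : Subgroup G} (hQ : Q ≤ P) :
    ∃ R : Subgroup G, IsFullyNormalized P R ∧ ∃ g : G, ∀ s, s ∈ Q ↔ g * s * g⁻¹ ∈ R := by
  obtain ⟨R, ⟨hR, g, hg⟩, hmax⟩ := Set.exists_max_image
    {R : Subgroup G | R ≤ P ∧ ∃ g : G, ∀ s, s ∈ Q ↔ g * s * g⁻¹ ∈ R}
    (fun R => Nat.card (normalizerIn P R)) (Set.toFinite _) ⟨Q, hQ, 1, by simp⟩
  refine ⟨R, ⟨hR, fun T hT hRT => hmax T ⟨hT, ?_⟩⟩, g, hg⟩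
  obtain ⟨x, hx⟩ := areConj_iff.1 hRT
  exact ⟨x * g, fun s => by rw [hg, hx]; congr! 1; group⟩

theorem isPGroup_autBy {p : ℕ} {K : Subgroup G} (hK : IsPGroup p K) (Q : Subgroup G) :
    IsPGroup p (autBy K Q) := by
  rintro ⟨φ, g, hg, hφ⟩
  obtain ⟨n, hn⟩ := hK ⟨g, hg⟩
  have hpow : ∀ (m : ℕ) (q : Q), ((φ ^ m) q : G) = g ^ m * q * (g ^ m)⁻¹ := by
    intro m
    induction m with
    | zero => intro q; simp
    | succ m ih => intro q; rw [pow_succ', MulAut.mul_apply, hφ, ih, pow_succ']; group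
  refine ⟨n, Subtype.ext (MulEquiv.ext fun q => Subtype.ext ?_)⟩
  have hn' : g ^ p ^ n = 1 := congrArg Subtype.val hn
  change ((φ ^ p ^ n) q : G) = q
  rw [hpow, hn']
  simp

/-- Every morphism onto a fully automized and receptive subgroup can be altered such that it
extends to the normalizer. -/
theorem exists_conj_normalizerIn_le [Finite G] {p : ℕ} [Fact p.Prime] {P R S : Subgroup G}
    (hP : IsPGroup p P) (hS : S ≤ P) (haut : IsFullyAutomized p P R) (hrec : IsReceptive P R)
    {x : G} (hx : ∀ s, s ∈ S ↔ x * s * x⁻¹ ∈ R) :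
    ∃ y : G, (∀ s, s ∈ S ↔ y * s * y⁻¹ ∈ R) ∧ ∀ m ∈ normalizerIn P S, y * m * y⁻¹ ∈ P := by
  -- Transported to `R`, the automorphisms coming from `N_P(S)` form a `p`-group. By Sylow, some `w`
  -- inducing an automorphism of `R` conjugates them into `Aut_P(R)`, so `x` is corrected to `w *
  -- x`.
  let K : Subgroup G := (normalizerIn P S).map (MulAut.conj x).toMonoidHom
  have hK : IsPGroup p K := (hP.to_le inf_le_left).map _
  have hT : IsPGroup p ((autBy K R).subgroupOf (autBy ⊤ R)) :=
    (isPGroup_autBy hK R).comap_subtype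
  obtain ⟨U, hU⟩ := hT.exists_le_sylow
  obtain ⟨V, hV⟩ := haut
  obtain ⟨α, hα⟩ := MulAction.exists_smul_eq (autBy ⊤ R) U V
  obtain ⟨w, -, hw⟩ := α.2
  have hwx : ∀ s, s ∈ S ↔ w * x * s * (w * x)⁻¹ ∈ R := by
    intro s
    rw [hx, mem_iff_conj_mem_of_equiv _ hw]
    congr! 1
    group
  let φ := conjEquiv (w * x) hwx
  have hext : normalizerIn P S ≤ extender P φ := by
    intro m hm
    have hxm : x * m * x⁻¹ ∈ Subgroup.normalizer (R : Set G) := conj_mem_normalizer hx hm.2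
    let β : MulAut R := conjEquiv (x * m * x⁻¹) (Subgroup.mem_normalizer_iff.1 hxm)
    have hβ : β ∈ autBy K R := ⟨x * m * x⁻¹, ⟨m, hm, rfl⟩, fun _ => rfl⟩
    have hβ' : β ∈ autBy ⊤ R := ⟨x * m * x⁻¹, Subgroup.mem_top _, fun _ => rfl⟩
    have hmem : (⟨β, hβ'⟩ : autBy ⊤ R) ∈ (U : Subgroup (autBy ⊤ R)) := hU hβ
    have h2 : α * ⟨β, hβ'⟩ * α⁻¹ ∈ (V : Subgroup (autBy ⊤ R)) := by
      rw [← hα, Sylow.coe_subgroup_smul]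
      exact Subgroup.smul_mem_pointwise_smul _ (MulAut.conj α) _ hmem
    rw [hV] at h2
    refine ⟨hm, _, h2, fun a b hab => ?_⟩
    have hinv : ∀ r : R, (((α : MulAut R)⁻¹ r : R) : G) = w⁻¹ * r * w := by
      intro r
      have := hw ((α : MulAut R)⁻¹ r)
      rw [MulAut.apply_inv_self] at this
      rw [this]; group
    apply Subtype.ext
    change (w * x) * b * (w * x)⁻¹ =
      (((α : MulAut R) (β ((α : MulAut R)⁻¹ (φ a))) : R) : G)
    rw [hw, coe_conjEquiv, hinv, coe_conjEquiv, hab]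
    group
  obtain ⟨ψ, ⟨y, hy⟩, hψ⟩ := hrec S hS φ ⟨w * x, fun _ => rfl⟩
  refine ⟨y, mem_iff_conj_mem_of_equiv φ fun s => ?_, fun m hm => ?_⟩
  · have hs : (s : G) ∈ extender P φ := hext ⟨hS s.2, Subgroup.le_normalizer s.2⟩
    rw [← hψ s hs, hy]
  · have := hy ⟨m, hext hm⟩
    rw [← this]
    exact (ψ _).2

/-- In a saturated fusion system, the normalizer in `P` of a conjugate of a fully normalized
subgroup `Q` is conjugate to a subgroup of the normalizer in `P` of `Q`. -/
theorem IsFullyNormalized.exists_conj_mem [Finite G] {p : ℕ} [Fact p.Prime] {P Q : Subgroup G}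
    (hP : IsPGroup p P) (hsat : IsSaturated p P) (hQ : IsFullyNormalized P Q) (g : G)
    (hg : ∀ q ∈ Q, g⁻¹ * q * g ∈ P) :
    ∃ n ∈ Subgroup.normalizer (Q : Set G), ∀ m ∈ Subgroup.normalizer (Q : Set G),
      g⁻¹ * m * g ∈ P → n * m * n⁻¹ ∈ P := by
  obtain ⟨R, hR, hQR, haut, hrec⟩ := hsat Q hQ.1
  obtain ⟨x, hx⟩ := areConj_iff.1 hQR
  obtain ⟨y, hy, hyP⟩ := exists_conj_normalizerIn_le hP hQ.1 haut hrec hx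
  -- One inclusion holds by the choice of `y`; full normalization of `Q` gives the comparison of
  -- orders that turns it into equality.
  have hmap : (normalizerIn P Q).map (MulAut.conj y).toMonoidHom = normalizerIn P R := by
    refine Subgroup.eq_of_le_of_card_ge ?_ ?_
    · rintro _ ⟨m, hm, rfl⟩
      exact ⟨hyP m hm, conj_mem_normalizer hy hm.2⟩
    · rw [Subgroup.card_map_of_injective (MulAut.conj y).injective]
      exact hQ.2 R hR hQR
  let S : Subgroup G := Q.comap (MulAut.conj g).toMonoidHom
  have hS : ∀ s, s ∈ S ↔ g * s * g⁻¹ ∈ Q := fun _ => Iff.rfl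
  have hSP : S ≤ P := by
    intro s hs
    have := hg _ ((hS s).1 hs)
    rwa [show g⁻¹ * (g * s * g⁻¹) * g = s by group] at this
  obtain ⟨z, hz, hzP⟩ := exists_conj_normalizerIn_le hP hSP haut hrec (x := x * g) (fun s => by
    rw [hS, hx]; congr! 1; group)
  have hS' : ∀ q, q ∈ Q ↔ g⁻¹ * q * g⁻¹⁻¹ ∈ S := fun q => by
    rw [hS]; congr! 1; group
  -- Go from `Q` to `S = g⁻¹ Q g`, then by `z` to `R`, then back by `y⁻¹`. The middle map sends
  -- `N_P(S)` into `N_P(R)`, which is exactly the conjugate of `N_P(Q)` by `y`.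
  refine ⟨y⁻¹ * z * g⁻¹, ?_, fun m hm hmP => ?_⟩
  · rw [Subgroup.mem_normalizer_iff]
    intro q
    rw [hS', hz, hy (y⁻¹ * z * g⁻¹ * q * (y⁻¹ * z * g⁻¹)⁻¹)]
    congr! 1
    group
  · have h1 : g⁻¹ * m * g⁻¹⁻¹ ∈ normalizerIn P S :=
      ⟨by rwa [inv_inv], conj_mem_normalizer hS' hm⟩
    have h2 : z * (g⁻¹ * m * g⁻¹⁻¹) * z⁻¹ ∈ normalizerIn P R :=
      ⟨hzP _ h1, conj_mem_normalizer hz h1.2⟩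
    rw [← hmap] at h2
    obtain ⟨d, hd, hd'⟩ := h2
    have h3 : y * d * y⁻¹ = z * (g⁻¹ * m * g⁻¹⁻¹) * z⁻¹ := hd'
    have h4 : y⁻¹ * z * g⁻¹ * m * (y⁻¹ * z * g⁻¹)⁻¹ = d := by
      rw [show d = y⁻¹ * (y * d * y⁻¹) * y by group, h3]
      group
    rw [h4]
    exact hd.1

end Fusion

/-! ### Scott idempotents and their occurrence in Brauer images. -/

namespace PermMatrix

open Matrix MulAction

variable {k X : Type*} [Field k] [Fintype X] [DecidableEq X]

theorem smul_mem_orbit_iff {N : Type*} [Group N] {Y : Type*} [MulAction N Y] (n : N) (x y : Y) :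
    n • x ∈ orbit N y ↔ x ∈ orbit N y := by
  rw [← orbit_eq_iff, orbit_smul, orbit_eq_iff]

theorem not_isNilpotent_of_mulVec_eq_smul {a : Matrix X X k} {v : X → k} {c : k} (hc : c ≠ 0)
    (hv : v ≠ 0) (h : a *ᵥ v = c • v) : ¬ IsNilpotent a := by
  rintro ⟨n, hn⟩
  have key : ∀ m : ℕ, (a ^ m) *ᵥ v = c ^ m • v := by
    intro m
    induction m with
    | zero => simp
    | succ m ih => rw [pow_succ, ← mulVec_mulVec, h, mulVec_smul, ih, smul_smul, pow_succ']
  have := key n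
  rw [hn, zero_mulVec] at this
  exact smul_ne_zero (pow_ne_zero n hc) hv this.symm

/-- `f` is a primitive idempotent whose image is a Scott module of the permutation module on the
orbit of `y`. -/
structure IsScottIdempotent (N : Type*) [Group N] [MulAction N X] (y : X) (f : Matrix X X k) :
    Prop extends IsPrimitive N f where
  eq_zero_left : ∀ u v, u ∉ orbit N y → f u v = 0
  eq_zero_right : ∀ u v, v ∉ orbit N y → f u v = 0
  sum_eq_one : ∀ u ∈ orbit N y, ∑ v, f u v = 1

-- Row sums 1 mean that `f` fixes the indicator of the orbit, the trivial submodule of the Scott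
-- module. This supplies the eigenvector showing that an element of the corner of `f` is not
-- nilpotent.
open scoped Classical in
theorem IsScottIdempotent.mulVec_indicator {N : Type*} [Group N] [MulAction N X] {y : X}
    {f : Matrix X X k} (hf : IsScottIdempotent N y f) (c : k) {w : X → k}
    (hw : ∀ u ∈ orbit N y, w u = c) : f *ᵥ w = c • (orbit N y).indicator 1 := by
  ext u
  rw [mulVec, dotProduct, Pi.smul_apply, smul_eq_mul]
  by_cases hu : u ∈ orbit N y
  · rw [Set.indicator_of_mem hu, Pi.one_apply, mul_one, ← one_mul c, ← hf.sum_eq_one u hu,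
      Finset.sum_mul]
    refine Finset.sum_congr rfl fun v _ => ?_
    by_cases hv : v ∈ orbit N y
    · rw [hw v hv]
    · rw [hf.eq_zero_right u v hv, zero_mul, zero_mul]
  · rw [Set.indicator_of_notMem hu, mul_zero]
    exact Finset.sum_eq_zero fun v _ => by rw [hf.eq_zero_left u v hu, zero_mul]

section

variable (p : ℕ) [Fact p.Prime] [CharP k p] {N : Type*} [Group N] [MulAction N X]

-- Splitting row `y` over the `N`-orbits, some orbit has nonzero sum. The `p`-group `stabilizer N y`
-- leaves the entries of this row invariant, so a point `z` fixed by it must contribute.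
open scoped Classical in
theorem exists_orbit_sum_ne_zero {y : X} (hD : IsPGroup p (stabilizer N y)) {e : Matrix X X k}
    (he : e ∈ invariantSubalgebra k X N) (hsum : ∑ x, e y x ≠ 0) :
    ∃ z : X, stabilizer N y ≤ stabilizer N z ∧ ∑ x with x ∈ orbit N z, e y x ≠ 0 := by
  have h1 := hsum
  rw [← Finset.sum_fiberwise_of_maps_to (g := fun x => (Quotient.mk'' x : orbitRel.Quotient N X))
    (t := Finset.univ.image fun x => (Quotient.mk'' x : orbitRel.Quotient N X))
    (fun x hx => Finset.mem_image_of_mem _ hx)] at h1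
  obtain ⟨ω, hω, h2⟩ := Finset.exists_ne_zero_of_sum_ne_zero h1
  obtain ⟨x₀, -, rfl⟩ := Finset.mem_image.1 hω
  have h3 : ∀ x, (Quotient.mk'' x : orbitRel.Quotient N X) = Quotient.mk'' x₀ ↔
      x ∈ orbit N x₀ := fun x => by
    rw [Quotient.eq'']; exact orbitRel_apply
  simp only [h3] at h2
  have h4 := h2
  rw [Finset.sum_filter, ← sum_le_stabilizer_eq_sum p hD] at h4
  · obtain ⟨z, hz, hz0⟩ := Finset.exists_ne_zero_of_sum_ne_zero h4
    have hzorb : z ∈ orbit N x₀ := by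
      by_contra hcon
      exact hz0 (if_neg hcon)
    refine ⟨z, (Finset.mem_filter.1 hz).2, ?_⟩
    rwa [orbit_eq_iff.2 hzorb]
  · intro d hd x
    have hdy : d • y = y := hd
    have h5 := he d y x
    rw [hdy] at h5
    rw [h5]
    congr 1
    exact propext (smul_mem_orbit_iff _ _ _)

end

section

variable (p : ℕ) [Fact p.Prime] [CharP k p] {G : Type*} [Group G] [MulAction G X]

/-- The Scott idempotent of `N_G(Q)` survives the Brauer maps of all relevant subgroups. -/
theorem IsScottIdempotent.br_ne_zero {N R : Subgroup G} {y : X} {f : Matrix X X k}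
    (hf : IsScottIdempotent N y f) (hRN : R ≤ N) (hR : IsPGroup p R) {u : X}
    (hu : u ∈ orbit N y) (hRu : R ≤ stabilizer G u) : br R f ≠ 0 := by
  classical
  intro h0
  -- Modulo `p`, the sum 1 of row `u` comes from the columns fixed by `R`; those entries survive in
  -- `br R f`.
  have h1 := hf.sum_eq_one u hu
  rw [← sum_le_stabilizer_eq_sum p hR] at h1
  · refine zero_ne_one (α := k) (Eq.trans ?_ h1)
    refine (Finset.sum_eq_zero fun x hx => ?_).symm
    rw [← br_apply f hRu (Finset.mem_filter.1 hx).2, h0, Matrix.zero_apply]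
  · intro r hr x
    have hru : r • u = u := hRu hr
    have h2 : f (r • u) (r • x) = f u x := hf.mem ⟨r, hRN hr⟩ u x
    rwa [hru] at h2

variable [Finite G]

/-- The Scott idempotent of `N_G(Q)` is equivalent to a summand of `br Q e`. -/
theorem exists_scott_summand {Q : Subgroup G} {y : X} (hQy : Q ≤ stabilizer G y)
    (hD : IsPGroup p (stabilizer (Subgroup.normalizer (Q : Set G)) y))
    (hfus : ∀ z : X, Q ≤ stabilizer G z → ∃ n : Subgroup.normalizer (Q : Set G),
      ∀ m : Subgroup.normalizer (Q : Set G), m • z = z → (n * m * n⁻¹) • y = y)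
    {e f : Matrix X X k} (he : e ∈ invariantSubalgebra k X G) (hee : e * e = e)
    (hsum : ∀ x, ∑ x', e x x' = 1)
    (hQ : IsPGroup p Q) (hf : IsScottIdempotent (Subgroup.normalizer (Q : Set G)) y f) :
    ∃ a ∈ invariantSubalgebra k X (Subgroup.normalizer (Q : Set G)),
      ∃ b ∈ invariantSubalgebra k X (Subgroup.normalizer (Q : Set G)),
        a * b = f ∧ f * a = a ∧ a * br Q e = a ∧ br Q e * b = b ∧ b * f = b := by
  classical
  set N := Subgroup.normalizer (Q : Set G)
  have heN := invariantSubalgebra_le N he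
  have heQ : br Q e ∈ invariantSubalgebra k X N := br_mem_invariantSubalgebra le_rfl heN
  have hidem : br Q e * br Q e = br Q e := by
    rw [← br_mul p hQ (invariantSubalgebra_le Q he) (invariantSubalgebra_le Q he), hee]
  obtain ⟨z, hyz, hc⟩ := exists_orbit_sum_ne_zero p hD heN (by rw [hsum]; exact one_ne_zero)
  set c := ∑ x with x ∈ orbit N z, e y x with hcdef
  have hQN : Q ≤ N := Subgroup.le_normalizer
  have hQz : Q ≤ stabilizer G z := by
    intro q hq
    have h : (⟨q, hQN hq⟩ : N) ∈ stabilizer N y := hQy hq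
    exact hyz h
  -- The stabilizer of `z` contains that of `y` and is conjugate into it, so the two coincide by
  -- order.
  have hzy : stabilizer N z ≤ stabilizer N y := by
    obtain ⟨n, hn⟩ := hfus z hQz
    have h1 : (stabilizer N z).map (MulAut.conj n).toMonoidHom ≤ stabilizer N y := by
      rintro _ ⟨m, hm, rfl⟩
      exact hn m hm
    have h2 := Subgroup.card_le_of_le h1
    rw [Subgroup.card_map_of_injective (MulAut.conj n).injective] at h2
    exact (Subgroup.eq_of_le_of_card_ge hyz h2).ge
  -- The matrix of the isomorphism between the two orbits that sends `n • y` to `n • z`; it is well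
  -- defined because the stabilizers agree.
  let t : Matrix X X k := fun u v => if ∃ n : N, u = n • z ∧ v = n • y then 1 else 0
  have ht : t ∈ invariantSubalgebra k X N := by
    intro n u v
    change (if _ then _ else _) = (if _ then _ else _)
    congr 1
    refine propext ⟨?_, ?_⟩
    · rintro ⟨m, hu, hv⟩
      exact ⟨n⁻¹ * m, by rw [mul_smul, ← hu, inv_smul_smul], by rw [mul_smul, ← hv, inv_smul_smul]⟩
    · rintro ⟨m, rfl, rfl⟩
      exact ⟨n * m, by rw [mul_smul], by rw [mul_smul]⟩
  have ht1 : t *ᵥ (orbit N y).indicator 1 = (orbit N z).indicator 1 := by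
    ext u
    rw [mulVec, dotProduct]
    by_cases hu : u ∈ orbit N z
    · rw [Set.indicator_of_mem hu, Pi.one_apply]
      obtain ⟨n, rfl⟩ := hu
      rw [Finset.sum_eq_single (n • y)]
      · rw [Set.indicator_of_mem (mem_orbit y n), Pi.one_apply, mul_one]
        exact if_pos ⟨n, rfl, rfl⟩
      · intro v _ hv
        have : t (n • z) v = 0 := by
          refine if_neg ?_
          rintro ⟨m, hm, rfl⟩
          have h1 : n⁻¹ * m ∈ stabilizer N z := by
            rw [mem_stabilizer_iff, mul_smul, ← hm, inv_smul_smul]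
          have h2 : (n⁻¹ * m) • y = y := hzy h1
          refine hv ?_
          rw [mul_smul, inv_smul_eq_iff] at h2
          exact h2
        exact (congrArg (· * _) this).trans (zero_mul _)
      · simp
    · rw [Set.indicator_of_notMem hu]
      refine Finset.sum_eq_zero fun v _ => ?_
      have : t u v = 0 := by
        refine if_neg ?_
        rintro ⟨m, rfl, -⟩
        exact hu (mem_orbit z m)
      rw [this, zero_mul]
  have hv : ∀ u ∈ orbit N y, (br Q e *ᵥ (orbit N z).indicator 1) u = c := by
    rintro _ ⟨n, rfl⟩
    change ∑ v, br Q e (n • y) v * (orbit N z).indicator 1 v = c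
    rw [← Equiv.sum_comp (MulAction.toPerm n), hcdef, Finset.sum_filter]
    refine Finset.sum_congr rfl fun x _ => ?_
    rw [MulAction.toPerm_apply, heQ n]
    by_cases hx : x ∈ orbit N z
    · have hQx : Q ≤ stabilizer G x := by
        obtain ⟨m, rfl⟩ := hx
        exact (le_stabilizer_smul_iff m.2 z).2 hQz
      rw [if_pos hx, Set.indicator_of_mem ((smul_mem_orbit_iff _ _ _).2 hx), br_apply _ hQy hQx,
        Pi.one_apply, mul_one]
    · rw [if_neg hx, Set.indicator_of_notMem fun h => hx ((smul_mem_orbit_iff _ _ _).1 h), mul_zero]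
  have hd : f * br Q e * t * f ∈ invariantSubalgebra k X N :=
    Subalgebra.mul_mem _ (Subalgebra.mul_mem _ (Subalgebra.mul_mem _ hf.mem heQ) ht) hf.mem
  -- The path `f → br Q e → f` has the indicator of the orbit of `y` as eigenvector with eigenvalue
  -- `c ≠ 0`, so it is invertible in the local corner ring of `f`.
  have hvec : (f * br Q e * t * f) *ᵥ (orbit N y).indicator 1 = c • (orbit N y).indicator 1 := by
    rw [← mulVec_mulVec, ← mulVec_mulVec, ← mulVec_mulVec,
      hf.mulVec_indicator 1 (w := (orbit N y).indicator 1)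
        (fun u hu => Set.indicator_of_mem hu _), one_smul, ht1,
      hf.mulVec_indicator c hv]
  have hnil := not_isNilpotent_of_mulVec_eq_smul hc (fun h0 => by
    have := congrFun h0 y
    rw [Set.indicator_of_mem (mem_orbit_self y)] at this
    exact one_ne_zero this) hvec
  obtain ⟨d, hdmem, hfd, hdf, hmul⟩ := hf.exists_mul_eq hd
    (by rw [← mul_assoc, ← mul_assoc, ← mul_assoc, hf.idem]) (by rw [mul_assoc, hf.idem]) hnil
  refine ⟨f * br Q e, Subalgebra.mul_mem _ hf.mem heQ, br Q e * t * f * d,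
    Subalgebra.mul_mem _ (Subalgebra.mul_mem _ (Subalgebra.mul_mem _ heQ ht) hf.mem) hdmem,
    ?_, ?_, ?_, ?_, ?_⟩
  · refine Eq.trans ?_ hmul
    rw [← mul_assoc, ← mul_assoc, ← mul_assoc, mul_assoc f, hidem]
  · rw [← mul_assoc, hf.idem]
  · rw [mul_assoc, hidem]
  · rw [← mul_assoc, ← mul_assoc, ← mul_assoc, hidem]
  · rw [mul_assoc, hdf]

end

end PermMatrix

/-! ### Lifting invariant matrices, and the comparison of `br Q e` with its Scott summand. -/

/-- Normalizers grow in the nilpotent group `S`; the statement is moved from subgroups of `S` to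
subgroups of `G`. -/
theorem IsPGroup.lt_inf_normalizer {G : Type*} [Group G] [Finite G] {p : ℕ} [Fact p.Prime]
    {Q S : Subgroup G} (hS : IsPGroup p S) (h : Q < S) :
    Q < S ⊓ Subgroup.normalizer (Q : Set G) := by
  refine lt_of_le_of_ne (le_inf h.le Subgroup.le_normalizer) fun heq => ?_
  have hnil : Group.IsNilpotent S := hS.isNilpotent
  have hlt : Q.subgroupOf S < ⊤ := by
    rw [lt_top_iff_ne_top, Ne, Subgroup.subgroupOf_eq_top]
    exact h.not_ge
  obtain ⟨s, hs, hs'⟩ := SetLike.exists_of_lt (Group.normalizerCondition_of_isNilpotent _ hlt)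
  refine hs' ?_
  rw [Subgroup.mem_subgroupOf, heq]
  refine ⟨s.2, ?_⟩
  rw [Subgroup.mem_normalizer_iff] at hs
  refine Subgroup.mem_normalizer_iff.2 ?_
  have hQ : ∀ q, q ∈ Q → q ∈ S := fun q hq => h.le hq
  intro q
  constructor
  · intro hq
    exact (hs ⟨q, hQ q hq⟩).1 hq
  · intro hq
    have hqS : q ∈ S := by
      have := S.mul_mem (S.mul_mem (S.inv_mem s.2) (hQ _ hq)) s.2
      rwa [show (s : G)⁻¹ * (s * q * (s : G)⁻¹) * s = q by group] at this
    exact (hs ⟨q, hqS⟩).2 hq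

namespace PermMatrix

open Matrix MulAction

variable {k X : Type*} [Field k] [Fintype X] [DecidableEq X]
  {G : Type*} [Group G] [MulAction G X]

/-- An `N_G(Q)`-invariant matrix supported on pairs with stabilizer `Q` lifts to a `G`-invariant
matrix. -/
theorem exists_br_eq [Finite G] {Q : Subgroup G} {m : Matrix X X k}
    (hm : m ∈ invariantSubalgebra k X (Subgroup.normalizer (Q : Set G)))
    (hsupp : ∀ x y, m x y ≠ 0 → stabilizer G x ⊓ stabilizer G y = Q) :
    ∃ l ∈ invariantSubalgebra k X G, br Q l = m := by
  classical
  -- If `(x, y)` and its translate by `g` both lie in the support, both have joint stabilizer `Q`,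
  -- so `g` normalizes `Q`. Hence spreading `m` over `G`-translates is unambiguous.
  have hnorm : ∀ (g : G) x y, m x y ≠ 0 → m (g • x) (g • y) ≠ 0 →
      m (g • x) (g • y) = m x y := by
    intro g x y h1 h2
    have h3 := hsupp _ _ h1
    have h4 := hsupp _ _ h2
    refine hm ⟨g, ?_⟩ x y
    rw [Subgroup.mem_normalizer_iff]
    intro q
    have h5 : ∀ z : X, q • z = z ↔ (g * q * g⁻¹) • g • z = g • z := fun z => by
      rw [← mul_smul, inv_mul_cancel_right, mul_smul, smul_left_cancel_iff]
    have h6 : q ∈ stabilizer G x ⊓ stabilizer G y ↔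
        g * q * g⁻¹ ∈ stabilizer G (g • x) ⊓ stabilizer G (g • y) :=
      and_congr (h5 x) (h5 y)
    rwa [h3, h4] at h6
  let l : Matrix X X k := fun u v =>
    if h : ∃ g : G, m (g • u) (g • v) ≠ 0 then m (h.choose • u) (h.choose • v) else 0
  have hl : ∀ (g : G) u v, m (g • u) (g • v) ≠ 0 → l u v = m (g • u) (g • v) := by
    intro g u v h
    have hex : ∃ g : G, m (g • u) (g • v) ≠ 0 := ⟨g, h⟩
    have h1 : l u v = m (hex.choose • u) (hex.choose • v) := dif_pos hex
    have h2 := hnorm (hex.choose * g⁻¹) (g • u) (g • v) h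
    rw [← mul_smul, ← mul_smul, inv_mul_cancel_right] at h2
    rw [h1, h2 hex.choose_spec]
  have hl0 : ∀ u v, (∀ g : G, m (g • u) (g • v) = 0) → l u v = 0 := by
    intro u v h
    exact dif_neg fun ⟨g, hg⟩ => hg (h g)
  refine ⟨l, ?_, ?_⟩
  · intro n u v
    by_cases h : ∃ g : G, m (g • u) (g • v) ≠ 0
    · obtain ⟨g, hg⟩ := h
      rw [hl g u v hg, hl (g * n⁻¹) (n • u) (n • v)]
      · rw [← mul_smul, ← mul_smul, inv_mul_cancel_right]
      · rwa [← mul_smul, ← mul_smul, inv_mul_cancel_right]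
    · push Not at h
      rw [hl0 u v h, hl0 (n • u) (n • v)]
      intro g
      rw [← mul_smul, ← mul_smul]
      exact h _
  · ext u v
    by_cases huv : Q ≤ stabilizer G u ∧ Q ≤ stabilizer G v
    · rw [br_apply _ huv.1 huv.2]
      by_cases h : ∃ g : G, m (g • u) (g • v) ≠ 0
      · obtain ⟨g, hg⟩ := h
        rw [hl g u v hg]
        -- If `Q` fixes `u` and `v`, then `g Q g⁻¹` fixes their translates, whose joint stabilizer
        -- is `Q`; so `g` normalizes `Q`.
        refine hm ⟨g, ?_⟩ u v
        have h1 := hsupp _ _ hg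
        refine Subgroup.mem_normalizer_fintype fun q hq => ?_
        rw [SetLike.mem_coe, ← h1]
        have h2 : ∀ w : X, Q ≤ stabilizer G w → (g * q * g⁻¹) • g • w = g • w := by
          intro w hw
          have h3 : q • w = w := hw hq
          rw [← mul_smul, inv_mul_cancel_right, mul_smul, h3]
        exact ⟨h2 u huv.1, h2 v huv.2⟩
      · push Not at h
        have := h 1
        rw [one_smul, one_smul] at this
        rw [hl0 u v h, this]
    · by_contra hne
      have h0 : br Q l u v = 0 := if_neg huv
      rw [h0] at hne
      have := hsupp u v fun h => hne h.symm
      exact huv ⟨this ▸ inf_le_left, this ▸ inf_le_right⟩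

/-- The exponent is positive because `br Q 1` is only the projection to the fixed points, not `1`.
-/
theorem br_pow_succ (p : ℕ) [Fact p.Prime] [CharP k p] {Q : Subgroup G} (hQ : IsPGroup p Q)
    {a : Matrix X X k} (ha : a ∈ invariantSubalgebra k X Q) (n : ℕ) :
    br Q (a ^ (n + 1)) = br Q a ^ (n + 1) := by
  induction n with
  | zero => simp
  | succ n ih => rw [pow_succ, br_mul p hQ (Subalgebra.pow_mem _ ha _) ha, ih, pow_succ _ (n + 1)]

/-- If the Brauer images of a primitive idempotent `e` are primitive for all `p`-subgroups properly
containing `Q`, then the image for `Q` is equivalent to any summand `f` whose Brauer images for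
these subgroups do not vanish. -/
theorem mul_eq_br_of_forall_lt [Finite G] (p : ℕ) [Fact p.Prime] [CharP k p] {Q : Subgroup G}
    (hQ : IsPGroup p Q) (hstab : ∀ x : X, IsPGroup p (stabilizer G x)) {e f a b : Matrix X X k}
    (he : IsPrimitive G e) (hf0 : f ≠ 0)
    (ha : a ∈ invariantSubalgebra k X (Subgroup.normalizer (Q : Set G)))
    (hb : b ∈ invariantSubalgebra k X (Subgroup.normalizer (Q : Set G)))
    (hab : a * b = f) (hfa : f * a = a) (hae : a * br Q e = a) (heb : br Q e * b = b)
    (hR : ∀ R : Subgroup G, Q < R → IsPGroup p R → br R e = 0 ∨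
      IsPrimitive ↥(R ⊔ Subgroup.centralizer (R : Set G)) (br R e))
    (hRf : ∀ R : Subgroup G, Q < R → R ≤ Subgroup.normalizer (Q : Set G) → IsPGroup p R →
      ∀ u : X, R ≤ stabilizer G u → br R f ≠ 0) :
    b * a = br Q e := by
  have hff : f * f = f := by
    nth_rewrite 2 [← hab]
    rw [← mul_assoc, hfa, hab]
  set N := Subgroup.normalizer (Q : Set G)
  have heQ : br Q e ∈ invariantSubalgebra k X N :=
    br_mem_invariantSubalgebra le_rfl (invariantSubalgebra_le N he.mem)
  have hidem : br Q e * br Q e = br Q e := by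
    rw [← br_mul p hQ (invariantSubalgebra_le Q he.mem) (invariantSubalgebra_le Q he.mem), he.idem]
  set e₁ := b * a with he₁
  have he₁mem : e₁ ∈ invariantSubalgebra k X N := Subalgebra.mul_mem _ hb ha
  have hee₁ : br Q e * e₁ = e₁ := by rw [he₁, ← mul_assoc, heb]
  have he₁e : e₁ * br Q e = e₁ := by rw [he₁, mul_assoc, hae]
  have he₁e₁ : e₁ * e₁ = e₁ := by
    rw [he₁, mul_assoc, ← mul_assoc a, hab, hfa]
  have hf₁ : a * e₁ * b = f := by
    rw [he₁, ← mul_assoc, hab, mul_assoc, hab, hff]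
  set e₂ := br Q e - e₁ with he₂
  have he₂mem : e₂ ∈ invariantSubalgebra k X N := Subalgebra.sub_mem _ heQ he₁mem
  have hee₂ : br Q e * e₂ = e₂ := by rw [he₂, mul_sub, hidem, hee₁]
  have he₂e : e₂ * br Q e = e₂ := by rw [he₂, sub_mul, hidem, he₁e]
  have he₂e₂ : e₂ * e₂ = e₂ := by
    rw [he₂, mul_sub, sub_mul, sub_mul, hidem, hee₁, he₁e, he₁e₁, sub_self, sub_zero]
  have he₁e₂ : e₁ * e₂ = 0 := by rw [he₂, mul_sub, he₁e, he₁e₁, sub_self]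
  by_contra hne
  have he₂0 : e₂ ≠ 0 := fun h => hne (sub_eq_zero.1 h).symm
  have hbr : ∀ R : Subgroup G, Q < R → R ≤ N → IsPGroup p R → ∀ u : X, R ≤ stabilizer G u →
      br R e₂ = 0 := by
    intro R hQR hRN hRp u hu
    have hmem : ∀ {c : Matrix X X k}, c ∈ invariantSubalgebra k X N →
        c ∈ invariantSubalgebra k X R := fun hc => invariantSubalgebra_mono hRN hc
    have h1 : br R e₁ ≠ 0 := by
      intro h0
      refine hRf R hQR hRN hRp u hu ?_
      rw [← hf₁, br_mul p hRp (hmem (Subalgebra.mul_mem _ ha he₁mem)) (hmem hb),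
        br_mul p hRp (hmem ha) (hmem he₁mem), h0, mul_zero, zero_mul]
    have h2 : br R e * br R e₁ = br R e₁ := by
      rw [← br_br hQR.le e, ← br_mul p hRp (hmem heQ) (hmem he₁mem), hee₁]
    have h3 : br R e₁ * br R e = br R e₁ := by
      rw [← br_br hQR.le e, ← br_mul p hRp (hmem he₁mem) (hmem heQ), he₁e]
    -- `br R e₁` is a nonzero idempotent below `br R e`, hence all of it.
    have h4 : br R e₁ = br R e := by
      rcases hR R hQR hRp with h0 | hprim
      · rw [h0, zero_mul] at h2
        exact absurd h2.symm h1
      · refine (hprim.eq_zero_or_eq _ ?_ ?_ h2 h3).resolve_left h1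
        -- `e₁` is invariant only under `N_G(Q)`, which suffices: `R` lies in it, and `C_G(R) ≤
        -- C_G(Q)`.
        · refine br_mem_invariantSubalgebra
            (Representation.mul_centralizer_le_normalizer R) (invariantSubalgebra_mono ?_ he₁mem)
          exact sup_le hRN ((Subgroup.centralizer_le hQR.le).trans
            (le_sup_right.trans (Representation.mul_centralizer_le_normalizer Q)))
        · rw [← br_mul p hRp (hmem he₁mem) (hmem he₁mem), he₁e₁]
    have h5 : br R e₁ + br R e₂ = br R e := by
      rw [← br_add, he₂, add_sub_cancel, br_br hQR.le]
    rwa [h4, add_eq_left] at h5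
  have hsupp : ∀ x y, e₂ x y ≠ 0 → stabilizer G x ⊓ stabilizer G y = Q := by
    intro x y hxy
    have hx : Q ≤ stabilizer G x := by
      by_contra hx
      refine hxy ?_
      rw [← hee₂, mul_apply]
      exact Finset.sum_eq_zero fun z _ => by rw [br_apply_left _ _ hx, zero_mul]
    have hy : Q ≤ stabilizer G y := by
      by_contra hy
      refine hxy ?_
      rw [← he₂e, mul_apply]
      exact Finset.sum_eq_zero fun z _ => by rw [br_apply_right _ _ hy, mul_zero]
    by_contra hne
    have hlt : Q < stabilizer G x ⊓ stabilizer G y :=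
      lt_of_le_of_ne (le_inf hx hy) (Ne.symm hne)
    have hS : IsPGroup p ↥(stabilizer G x ⊓ stabilizer G y) := (hstab x).to_le inf_le_left
    -- The joint stabilizer need not normalize `Q`, so `hbr` is applied to its intersection with
    -- `N_G(Q)`, still strictly larger than `Q`.
    have h0 := hbr _ (hS.lt_inf_normalizer hlt) inf_le_right (hS.to_le inf_le_left) x
      (inf_le_left.trans inf_le_left)
    refine hxy ?_
    rw [← br_apply e₂ (inf_le_left.trans inf_le_left : _ ≤ stabilizer G x)
      (inf_le_left.trans inf_le_right : _ ≤ stabilizer G y), h0, Matrix.zero_apply]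
  -- The element `e * l * e` of the corner of `e` has Brauer image `e₂`, a nonzero idempotent, so it
  -- is not nilpotent and hence is invertible there.
  obtain ⟨l, hl, hle⟩ := exists_br_eq he₂mem hsupp
  have hmem : e * l * e ∈ invariantSubalgebra k X G :=
    Subalgebra.mul_mem _ (Subalgebra.mul_mem _ he.mem hl) he.mem
  have hQmem : ∀ {c : Matrix X X k}, c ∈ invariantSubalgebra k X G →
      c ∈ invariantSubalgebra k X Q := fun hc => invariantSubalgebra_le Q hc
  have hbrl : br Q (e * l * e) = e₂ := by
    rw [br_mul p hQ (hQmem (Subalgebra.mul_mem _ he.mem hl)) (hQmem he.mem),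
      br_mul p hQ (hQmem he.mem) (hQmem hl), hle, hee₂, he₂e]
  have hnil : ¬ IsNilpotent (e * l * e) := by
    rintro ⟨n, hn⟩
    have h1 := br_pow_succ p hQ (hQmem hmem) n
    have h2 : e₂ ^ (n + 1) = e₂ := IsIdempotentElem.pow_succ_eq n he₂e₂
    rw [pow_succ, hn, zero_mul, br_zero, hbrl, h2] at h1
    exact he₂0 h1.symm
  obtain ⟨c, hc, -, -, hmul⟩ := he.exists_mul_eq hmem
    (by rw [← mul_assoc, ← mul_assoc, he.idem]) (by rw [mul_assoc, he.idem]) hnil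
  have h1 : e₂ * br Q c = br Q e := by
    rw [← hbrl, ← br_mul p hQ (hQmem hmem) (hQmem hc), hmul]
  -- Multiplying `br Q e = e₂ * br Q c` by `e₁` on the left kills the right-hand side.
  have h2 : e₁ = 0 := by rw [← he₁e, ← h1, ← mul_assoc, he₁e₂, zero_mul]
  refine hf0 ?_
  rw [← hf₁, h2, mul_zero, zero_mul]

end PermMatrix

/-! ### Conjugation, and the criterion for idempotents. -/

namespace PermMatrix

open Matrix MulAction

variable {k X : Type*} [Field k] [Fintype X] {G : Type*} [Group G]

theorem conj_mem_sup_centralizer {Q R : Subgroup G} {g : G} (h : ∀ q, q ∈ Q ↔ g * q * g⁻¹ ∈ R)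
    {x : G} (hx : x ∈ Q ⊔ Subgroup.centralizer (Q : Set G)) :
    g * x * g⁻¹ ∈ R ⊔ Subgroup.centralizer (R : Set G) := by
  have key : Q ⊔ Subgroup.centralizer (Q : Set G) ≤
      (R ⊔ Subgroup.centralizer (R : Set G)).comap (MulAut.conj g).toMonoidHom := by
    refine sup_le (fun q hq => ?_) (fun c hc => ?_)
    · exact Subgroup.mem_sup_left ((h q).1 hq)
    · refine Subgroup.mem_sup_right ?_
      rw [Subgroup.mem_centralizer_iff] at hc ⊢
      intro r hr
      have hr' : g⁻¹ * r * g ∈ Q := by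
        rw [h, show g * (g⁻¹ * r * g) * g⁻¹ = r by group]
        exact hr
      have h1 := congrArg (fun w => g * w * g⁻¹) (hc _ hr')
      change r * (g * c * g⁻¹) = g * c * g⁻¹ * r
      simpa [mul_assoc] using h1
  exact key hx

variable [MulAction G X]

theorem submatrix_smul_mul (g : G) (a b : Matrix X X k) :
    (a * b).submatrix (g • ·) (g • ·) =
      a.submatrix (g • ·) (g • ·) * b.submatrix (g • ·) (g • ·) :=
  (submatrix_mul_equiv a b _ (MulAction.toPerm g) _).symm

variable [DecidableEq X]

theorem submatrix_mem_invariantSubalgebra {H K : Subgroup G} (g : G)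
    (h : ∀ x ∈ H, g * x * g⁻¹ ∈ K) {a : Matrix X X k} (ha : a ∈ invariantSubalgebra k X K) :
    a.submatrix (g • ·) (g • ·) ∈ invariantSubalgebra k X H := by
  intro n x y
  have h1 := ha ⟨g * n * g⁻¹, h n n.2⟩ (g • x) (g • y)
  have h2 : ∀ z : X, (⟨g * n * g⁻¹, h n n.2⟩ : K) • g • z = g • n • z := fun z => by
    change (g * n * g⁻¹) • g • z = g • (n : G) • z
    rw [← mul_smul, ← mul_smul, inv_mul_cancel_right]
  rwa [h2, h2] at h1

theorem IsPrimitive.submatrix {H K : Subgroup G} (g : G) (h : ∀ x, x ∈ H ↔ g * x * g⁻¹ ∈ K)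
    {e : Matrix X X k} (he : IsPrimitive K e) :
    IsPrimitive H (e.submatrix (g • ·) (g • ·)) := by
  have hinv : ∀ a : Matrix X X k,
      (a.submatrix (g⁻¹ • ·) (g⁻¹ • ·)).submatrix (g • ·) (g • ·) = a := fun a => by
    ext x y; simp
  have hinv' : ∀ a : Matrix X X k,
      (a.submatrix (g • ·) (g • ·)).submatrix (g⁻¹ • ·) (g⁻¹ • ·) = a := fun a => by
    ext x y; simp
  have hK : ∀ x ∈ K, g⁻¹ * x * g⁻¹⁻¹ ∈ H := fun x hx => by
    rw [h]
    rwa [show g * (g⁻¹ * x * g⁻¹⁻¹) * g⁻¹ = x by group]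
  refine ⟨fun h0 => he.ne_zero ?_, ?_, submatrix_mem_invariantSubalgebra g
    (fun x => (h x).1) he.mem, fun f hf hff hef hfe => ?_⟩
  · rw [← hinv' e, h0]
    rfl
  · rw [← submatrix_smul_mul, he.idem]
  · have h1 := he.eq_zero_or_eq (f.submatrix (g⁻¹ • ·) (g⁻¹ • ·))
      (submatrix_mem_invariantSubalgebra g⁻¹ hK hf)
      (by rw [← submatrix_smul_mul, hff])
      (by rw [← hinv' e, ← submatrix_smul_mul, hef])
      (by rw [← hinv' e, ← submatrix_smul_mul, hfe])
    rcases h1 with h1 | h1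
    · left; rw [← hinv f, h1]; rfl
    · right; rw [← hinv f, h1]

/-- Translating both indices by `g` leaves the invariant matrix `e` unchanged and carries the fixed
points of `Q` to those of `R`. With `IsPrimitive.submatrix`, this lets a subgroup be replaced by a
conjugate. -/
theorem br_submatrix {Q R : Subgroup G} {g : G} (h : ∀ q, q ∈ Q ↔ g * q * g⁻¹ ∈ R)
    {e : Matrix X X k} (he : e ∈ invariantSubalgebra k X G) :
    (br R e).submatrix (g • ·) (g • ·) = br Q e := by
  have key : ∀ z : X, R ≤ stabilizer G (g • z) ↔ Q ≤ stabilizer G z := by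
    intro z
    constructor
    · intro hz q hq
      have h1 : (g * q * g⁻¹) • g • z = g • z := hz ((h q).1 hq)
      rw [← mul_smul, inv_mul_cancel_right, mul_smul, smul_left_cancel_iff] at h1
      exact h1
    · intro hz r hr
      have h1 : (g⁻¹ * r * g) • z = z := hz (by
        rw [h, show g * (g⁻¹ * r * g) * g⁻¹ = r by group]
        exact hr)
      rw [mul_smul, mul_smul, inv_smul_eq_iff] at h1
      exact h1
  classical
  ext x y
  exact if_congr (and_congr (key x) (key y)) (he g x y) rfl

/-- Replacing `Q` by the product with a normal subgroup that acts trivially preserves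
indecomposability. -/
theorem IsPrimitive.br_of_sup {Q C : Subgroup G} (hC : ∀ x : X, C ≤ stabilizer G x)
    {e : Matrix X X k} (he : e ∈ invariantSubalgebra k X G)
    (h : IsPrimitive ↥((Q ⊔ C) ⊔ Subgroup.centralizer ((Q ⊔ C : Subgroup G) : Set G))
      (br (Q ⊔ C) e)) :
    IsPrimitive ↥(Q ⊔ Subgroup.centralizer (Q : Set G)) (br Q e) := by
  have heq : br (Q ⊔ C) e = br Q e := br_sup_eq hC e
  rw [heq] at h
  refine ⟨h.ne_zero, h.idem, br_mem_invariantSubalgebra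
    (Representation.mul_centralizer_le_normalizer Q) (invariantSubalgebra_le _ he),
    fun f hf hff hef hfe => h.eq_zero_or_eq f ?_ hff hef hfe⟩
  -- `f` is supported on the fixed points of `Q`, and invariant under `Q C_G(Q)`
  have hl : ∀ x y, ¬ Q ≤ stabilizer G x → f x y = 0 := fun x y hx => by
    rw [← hef, mul_apply]
    exact Finset.sum_eq_zero fun z _ => by rw [br_apply_left _ _ hx, zero_mul]
  have hr : ∀ x y, ¬ Q ≤ stabilizer G y → f x y = 0 := fun x y hy => by
    rw [← hfe, mul_apply]
    exact Finset.sum_eq_zero fun z _ => by rw [br_apply_right _ _ hy, mul_zero]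
  let S : Subgroup G :=
    { carrier := {g | ∀ x y, f (g • x) (g • y) = f x y}
      one_mem' := fun x y => by rw [one_smul, one_smul]
      mul_mem' := fun {a b} ha hb x y => by rw [mul_smul, mul_smul, ha, hb]
      inv_mem' := fun {a} ha x y => by
        have := ha (a⁻¹ • x) (a⁻¹ • y)
        rw [smul_inv_smul, smul_inv_smul] at this
        exact this.symm }
  have hS : ∀ s : G, s ∈ S ↔ ∀ x y, f (s • x) (s • y) = f x y := fun _ => Iff.rfl
  have hQC : Q ⊔ Subgroup.centralizer (Q : Set G) ≤ S := fun s hs x y => hf ⟨s, hs⟩ x y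
  have hCS : C ≤ S := fun c hc x y => by
    rw [show c • x = x from hC x hc, show c • y = y from hC y hc]
  -- `C` fixes every index, and `C_G(QC) ≤ C_G(Q)`, so invariance under `Q C_G(Q)` already gives
  -- invariance under `QC C_G(QC)`.
  have hle : (Q ⊔ C) ⊔ Subgroup.centralizer ((Q ⊔ C : Subgroup G) : Set G) ≤ S :=
    sup_le (sup_le (le_sup_left.trans hQC) hCS)
      ((Subgroup.centralizer_le (SetLike.coe_subset_coe.2 le_sup_left)).trans
        (le_sup_right.trans hQC))
  exact fun n x y => hle n.2 x y

theorem smul_mk_eq_iff {P : Subgroup G} (m g : G) :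
    m • (g : G ⧸ P) = (g : G ⧸ P) ↔ g⁻¹ * m * g ∈ P := by
  rw [MulAction.Quotient.smul_coe, eq_comm, QuotientGroup.eq, smul_eq_mul, mul_assoc]

/-- The criterion for Brauer indecomposability of Scott modules, in terms of idempotents. -/
theorem forall_br_isPrimitive_iff [Finite G] (p : ℕ) [Fact p.Prime] [CharP k p] {P : Subgroup G}
    [Fintype (G ⧸ P)] [DecidableEq (G ⧸ P)]
    (hP : IsPGroup p P) (hsat : Fusion.IsSaturated p P) {e : Matrix (G ⧸ P) (G ⧸ P) k}
    (he : IsScottIdempotent G ((1 : G) : G ⧸ P) e)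
    (f : Subgroup G → Matrix (G ⧸ P) (G ⧸ P) k) (hf : ∀ Q ≤ P,
      IsScottIdempotent (Subgroup.normalizer (Q : Set G)) ((1 : G) : G ⧸ P) (f Q)) :
    (∀ Q : Subgroup G, IsPGroup p Q → br Q e = 0 ∨
      IsPrimitive ↥(Q ⊔ Subgroup.centralizer (Q : Set G)) (br Q e)) ↔
    ∀ Q : Subgroup G, P.normalCore ≤ Q → Q ≤ P → Fusion.IsFullyNormalized P Q →
      IsPrimitive ↥(Q ⊔ Subgroup.centralizer (Q : Set G)) (f Q) := by
  have hstab1 : ∀ m : G, m ∈ stabilizer G ((1 : G) : G ⧸ P) ↔ m ∈ P := fun m => by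
    rw [mem_stabilizer_iff, smul_mk_eq_iff]
    simp
  have hsum : ∀ x, ∑ x', e x x' = 1 := fun x => he.sum_eq_one x (by
    rw [MulAction.orbit_eq_univ]; trivial)
  have hstab : ∀ x : G ⧸ P, IsPGroup p (stabilizer G x) := by
    intro x
    induction x using QuotientGroup.induction_on with
    | H g =>
      refine (hP.map (MulAut.conj g).toMonoidHom).to_le fun m hm => ?_
      rw [mem_stabilizer_iff, smul_mk_eq_iff] at hm
      exact ⟨_, hm, by simp [mul_assoc]⟩
  -- This is where saturation is used: the stabilizers in `N_G(Q)` of the `Q`-fixed points are all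
  -- conjugate into that of the base point.
  have hfus : ∀ Q, Fusion.IsFullyNormalized P Q → ∀ z : G ⧸ P, Q ≤ stabilizer G z →
      ∃ n : Subgroup.normalizer (Q : Set G), ∀ m : Subgroup.normalizer (Q : Set G),
        m • z = z → (n * m * n⁻¹) • ((1 : G) : G ⧸ P) = ((1 : G) : G ⧸ P) := by
    intro Q hQ z hz
    induction z using QuotientGroup.induction_on with
    | H g =>
      obtain ⟨n, hn, hnm⟩ := hQ.exists_conj_mem hP hsat g fun q hq => (smul_mk_eq_iff q g).1 (hz hq)
      refine ⟨⟨n, hn⟩, fun m hm => ?_⟩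
      exact (hstab1 _).2 (hnm m m.2 ((smul_mk_eq_iff _ g).1 hm))
  have hD : ∀ Q : Subgroup G,
      IsPGroup p (stabilizer (Subgroup.normalizer (Q : Set G)) ((1 : G) : G ⧸ P)) := by
    intro Q
    exact (hstab ((1 : G) : G ⧸ P)).comap_subtype (K := Subgroup.normalizer (Q : Set G))
  have hsummand := fun (Q : Subgroup G) (hQ : Fusion.IsFullyNormalized P Q) =>
    exists_scott_summand p (fun q hq => (hstab1 q).2 (hQ.1 hq)) (hD Q) (hfus Q hQ) he.mem he.idem
      hsum (hP.to_le hQ.1) (hf Q hQ.1)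
  constructor
  · intro h Q _ hQP hQ
    obtain ⟨a, ha, b, hb, hab, hfa, hae, heb, hbf⟩ := hsummand Q hQ
    have hle := Representation.mul_centralizer_le_normalizer Q
    rcases h Q (hP.to_le hQP) with h0 | hprim
    · rw [h0, mul_zero] at hae
      rw [← hae, zero_mul] at hab
      exact absurd hab.symm (hf Q hQP).ne_zero
    · have hba : b * a = br Q e := by
        refine (hprim.eq_zero_or_eq _ (invariantSubalgebra_mono hle (Subalgebra.mul_mem _ hb ha))
          ?_ ?_ ?_).resolve_left ?_
        · rw [mul_assoc, ← mul_assoc a, hab, hfa]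
        · rw [← mul_assoc, heb]
        · rw [mul_assoc, hae]
        · intro h0
          refine (hf Q hQP).ne_zero ?_
          rw [← (hf Q hQP).idem]
          nth_rewrite 1 [← hab]
          rw [← hab, mul_assoc, ← mul_assoc b, h0, zero_mul, mul_zero]
      exact hprim.of_equiv (invariantSubalgebra_mono hle ha) (invariantSubalgebra_mono hle hb)
        hab hba hae heb
  · intro h
    -- Downward induction on the order of `Q`, organized as strong induction on `|G| - |Q|`.
    suffices key : ∀ (n : ℕ) (Q : Subgroup G), IsPGroup p Q → Nat.card G - Nat.card Q = n →
        br Q e = 0 ∨ IsPrimitive ↥(Q ⊔ Subgroup.centralizer (Q : Set G)) (br Q e) from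
      fun Q hQ => key _ Q hQ rfl
    intro n
    induction n using Nat.strong_induction_on with
    | h n ih =>
    intro Q hQ hn
    have ihcard : ∀ R : Subgroup G, Nat.card Q < Nat.card R → IsPGroup p R →
        br R e = 0 ∨ IsPrimitive ↥(R ⊔ Subgroup.centralizer (R : Set G)) (br R e) := by
      intro R hQR hR
      have := Subgroup.card_le_card_group R
      exact ih _ (by omega) R hR rfl
    have hcard : ∀ {A B : Subgroup G}, A < B → Nat.card A < Nat.card B := by
      intro A B hAB
      refine lt_of_le_of_ne (Subgroup.card_le_of_le hAB.le) fun heq => hAB.ne ?_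
      exact Subgroup.eq_of_le_of_card_ge hAB.le heq.ge
    have hcoreN : ∀ x : G ⧸ P, P.normalCore ≤ stabilizer G x := by
      intro x c hc
      induction x using QuotientGroup.induction_on with
      | H g =>
        rw [mem_stabilizer_iff, smul_mk_eq_iff]
        have := (Subgroup.normalCore_normal P).conj_mem c hc g⁻¹
        rw [inv_inv] at this
        exact P.normalCore_le this
    by_cases hcore : P.normalCore ≤ Q
    swap
    · have hlt : Q < Q ⊔ P.normalCore := lt_of_le_of_ne le_sup_left fun heq =>
        hcore (heq ▸ le_sup_right)
      have hp : IsPGroup p ↥(Q ⊔ P.normalCore) :=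
        hQ.to_sup_of_normal_right (hP.to_le P.normalCore_le)
      rcases ihcard _ (hcard hlt) hp with h0 | hprim
      · left
        rw [← br_sup_eq hcoreN, h0]
      · exact Or.inr (hprim.br_of_sup hcoreN he.mem)
    by_cases hfix : ∃ z : G ⧸ P, Q ≤ stabilizer G z
    swap
    · left
      push Not at hfix
      ext x y
      exact br_apply_left _ _ (hfix x)
    obtain ⟨z, hz⟩ := hfix
    obtain ⟨g, rfl⟩ := QuotientGroup.mk_surjective z
    let S : Subgroup G := Q.comap (MulAut.conj g).toMonoidHom
    have hS : ∀ s, s ∈ S ↔ g * s * g⁻¹ ∈ Q := fun _ => Iff.rfl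
    have hSP : S ≤ P := by
      intro s hs
      have := (smul_mk_eq_iff _ g).1 (hz ((hS s).1 hs))
      rwa [show g⁻¹ * (g * s * g⁻¹) * g = s by group] at this
    obtain ⟨R, hR, x, hx⟩ := Fusion.exists_isFullyNormalized hSP
    have hQR : ∀ q, q ∈ Q ↔ (x * g⁻¹) * q * (x * g⁻¹)⁻¹ ∈ R := by
      intro q
      rw [show x * g⁻¹ * q * (x * g⁻¹)⁻¹ = x * (g⁻¹ * q * g) * x⁻¹ by group, ← hx, hS]
      congr! 1
      group
    have hcardR : Nat.card R = Nat.card Q := (Nat.card_congr (Fusion.conjEquiv _ hQR).toEquiv).symm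
    have hcoreR : P.normalCore ≤ R := by
      intro c hc
      have h1 := hcore ((Subgroup.normalCore_normal P).conj_mem c hc (x * g⁻¹)⁻¹)
      rw [hQR] at h1
      convert h1 using 1
      group
    have hRp : IsPGroup p R := hP.to_le hR.1
    obtain ⟨a, ha, b, hb, hab, hfa, hae, heb, hbf⟩ := hsummand R hR
    have hle := Representation.mul_centralizer_le_normalizer R
    have hba : b * a = br R e := by
      refine mul_eq_br_of_forall_lt p hRp hstab he.toIsPrimitive (hf R hR.1).ne_zero ha hb hab hfa
        hae heb (fun T hT hTp => ihcard T (hcardR ▸ hcard hT) hTp) fun T hT hTN hTp u hu => ?_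
      -- The point `u` fixed by `T` may lie outside the orbit carrying `f R`. Its stabilizer in
      -- `N_G(R)` is conjugate into that of the base point, so `T` also fixes a point of this orbit.
      obtain ⟨m, hm⟩ := hfus R hR u (hT.le.trans hu)
      refine (hf R hR.1).br_ne_zero p hTN hTp (mem_orbit _ m⁻¹) fun t ht => ?_
      have h1 := hm ⟨t, hTN ht⟩ (hu ht)
      rw [mul_smul, mul_smul, ← eq_inv_smul_iff] at h1
      exact h1
    have hprim := (h R hcoreR hR.1 hR).of_equiv (invariantSubalgebra_mono hle hb)
      (invariantSubalgebra_mono hle ha) hba hab hbf hfa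
    right
    rw [← br_submatrix hQR he.mem]
    refine hprim.submatrix (x * g⁻¹) fun w => ⟨conj_mem_sup_centralizer hQR, fun hw => ?_⟩
    have hRQ : ∀ r, r ∈ R ↔ (x * g⁻¹)⁻¹ * r * (x * g⁻¹)⁻¹⁻¹ ∈ Q := fun r => by
      rw [hQR]; congr! 1; group
    have := conj_mem_sup_centralizer hRQ hw
    rwa [show (x * g⁻¹)⁻¹ * (x * g⁻¹ * w * (x * g⁻¹)⁻¹) * (x * g⁻¹)⁻¹⁻¹ = w by group] at this

end PermMatrix

/-! ### From direct summands of permutation modules to idempotent matrices. -/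

namespace PermMatrix

open Matrix MulAction Representation

variable {k X : Type*} [Field k] [Fintype X]

section Realization

variable {N : Type*} [Group N] [MulAction N X] {U : Type*} [AddCommGroup U] [Module k U]

/-- The equivariant maps `i` and `π` exhibit the representation `σ` as the direct summand of the
permutation module `k^X` that is the image of the idempotent matrix `f`. -/
structure IsRealizedBy (σ : Representation k N U) (f : Matrix X X k) (i : U →ₗ[k] X → k)
    (π : (X → k) →ₗ[k] U) : Prop where
  apply_apply : ∀ u, π (i u) = u
  apply_eq_mulVec : ∀ v, i (π v) = f *ᵥ v
  smul_left : ∀ (n : N) u x, i (σ n u) (n • x) = i u x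
  smul_right : ∀ (n : N) v w, (∀ x, w (n • x) = v x) → π w = σ n (π v)

theorem IsRealizedBy.resQC {G : Type*} [Group G] [MulAction G X] {Q : Subgroup G}
    {σ : Representation k (Subgroup.normalizer (Q : Set G)) U} {f : Matrix X X k}
    {i : U →ₗ[k] X → k} {π : (X → k) →ₗ[k] U} (h : IsRealizedBy σ f i π) :
    IsRealizedBy (resQC Q σ) f i π :=
  ⟨h.apply_apply, h.apply_eq_mulVec, fun n => h.smul_left (Subgroup.inclusion
    (mul_centralizer_le_normalizer Q) n), fun n => h.smul_right (Subgroup.inclusion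
    (mul_centralizer_le_normalizer Q) n)⟩

namespace IsRealizedBy

variable {σ : Representation k N U} {f : Matrix X X k} {i : U →ₗ[k] X → k}
  {π : (X → k) →ₗ[k] U}

theorem mulVec_apply (h : IsRealizedBy σ f i π) (u : U) : f *ᵥ i u = i u := by
  rw [← h.apply_eq_mulVec, h.apply_apply]

theorem injective (h : IsRealizedBy σ f i π) : Function.Injective i :=
  Function.LeftInverse.injective h.apply_apply

theorem mul_self (h : IsRealizedBy σ f i π) : f * f = f := by
  refine Matrix.mulVec_injective (funext fun v => ?_)
  rw [← mulVec_mulVec, ← h.apply_eq_mulVec v, h.mulVec_apply]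

theorem eq_zero_iff (h : IsRealizedBy σ f i π) : f = 0 ↔ Subsingleton U := by
  constructor
  · rintro rfl
    refine ⟨fun a b => ?_⟩
    rw [← h.apply_apply a, ← h.apply_apply b, ← h.mulVec_apply a, ← h.mulVec_apply b, zero_mulVec,
      zero_mulVec]
  · intro hU
    refine Matrix.mulVec_injective (funext fun v => ?_)
    rw [← h.apply_eq_mulVec, Subsingleton.elim (π v) 0, map_zero, zero_mulVec]

variable [DecidableEq X]

/-- The relation `w (n • x) = v x` says that `w` is the translate of `v` by `n`, so the hypothesis
is equivariance of `g`; standard basis vectors turn it into invariance of the entries. -/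
theorem mem_of_forall_mulVec {g : Matrix X X k} (hg : ∀ (n : N) (v w : X → k),
    (∀ x, w (n • x) = v x) → ∀ x, (g *ᵥ w) (n • x) = (g *ᵥ v) x) :
    g ∈ invariantSubalgebra k X N := by
  intro n x y
  have h1 := hg n (Pi.single y 1) (Pi.single (n • y) 1) (fun z => by
    simp only [Pi.single_apply, smul_left_cancel_iff]) x
  rwa [mulVec_single_one, mulVec_single_one] at h1

theorem mulVec_smul_apply {g : Matrix X X k} (hg : g ∈ invariantSubalgebra k X N) (n : N)
    {v w : X → k} (hvw : ∀ x, w (n • x) = v x) (x : X) : (g *ᵥ w) (n • x) = (g *ᵥ v) x := by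
  simp only [mulVec, dotProduct]
  rw [← Equiv.sum_comp (MulAction.toPerm n)]
  exact Finset.sum_congr rfl fun z _ => by rw [toPerm_apply, hg n, hvw]

theorem mem (h : IsRealizedBy σ f i π) : f ∈ invariantSubalgebra k X N := by
  refine mem_of_forall_mulVec fun n v w hvw x => ?_
  rw [← h.apply_eq_mulVec, ← h.apply_eq_mulVec, h.smul_right n v w hvw, h.smul_left]

/-- Invariant idempotents below `f` correspond to equivariant projections of `U`, via `g ↦ π ∘ g ∘
i` and `q ↦ i ∘ q ∘ π`, and such projections correspond to decompositions of `U`. -/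
theorem isIndecomposable_iff (h : IsRealizedBy σ f i π) :
    σ.IsIndecomposable ↔ IsPrimitive N f := by
  constructor
  · rintro ⟨hU, hdec⟩
    refine ⟨fun h0 => not_subsingleton U (h.eq_zero_iff.1 h0), h.mul_self, h.mem,
      fun g hg hgg hfg hgf => ?_⟩
    let q : U →ₗ[k] U := π ∘ₗ g.mulVecLin ∘ₗ i
    have hq : ∀ u, i (q u) = g *ᵥ i u := by
      intro u
      change i (π (g *ᵥ i u)) = _
      rw [h.apply_eq_mulVec, mulVec_mulVec, hfg]
    have hqq : IsIdempotentElem q := by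
      refine LinearMap.ext fun u => h.injective ?_
      change i (q (q u)) = i (q u)
      rw [hq, hq, mulVec_mulVec, hgg]
    have hqσ : ∀ n u, q (σ n u) = σ n (q u) := by
      intro n u
      refine h.smul_right n _ _ fun x => ?_
      exact mulVec_smul_apply hg n (h.smul_left n u) x
    let A : Subrepresentation σ := ⟨LinearMap.range q, by
      rintro n _ ⟨u, rfl⟩
      exact ⟨σ n u, hqσ n u⟩⟩
    let B : Subrepresentation σ := ⟨LinearMap.ker q, by
      intro n u hu
      rw [LinearMap.mem_ker] at hu ⊢
      rw [hqσ, hu, map_zero]⟩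
    have hAB : IsCompl A B := isCompl_toSubmodule.2 (LinearMap.IsIdempotentElem.isCompl hqq)
    have hgv : ∀ v, g *ᵥ v = i (q (π v)) := by
      intro v
      rw [hq, h.apply_eq_mulVec, mulVec_mulVec, hgf]
    rcases hdec A B hAB with h0 | h0
    · left
      have h1 : LinearMap.range q = ⊥ := congrArg Subrepresentation.toSubmodule h0
      rw [LinearMap.range_eq_bot] at h1
      refine Matrix.mulVec_injective (funext fun v => ?_)
      rw [hgv, h1, LinearMap.zero_apply, map_zero, zero_mulVec]
    · right
      have h1 : LinearMap.ker q = ⊥ := congrArg Subrepresentation.toSubmodule h0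
      refine Matrix.mulVec_injective (funext fun v => ?_)
      have h2 : q (π v) = π v :=
        LinearMap.ker_eq_bot.1 h1 (LinearMap.congr_fun hqq (π v))
      rw [hgv, h2, h.apply_eq_mulVec]
  · intro hf
    refine ⟨not_subsingleton_iff_nontrivial.1 fun hU => hf.ne_zero (h.eq_zero_iff.2 hU),
      fun A B hAB => ?_⟩
    have hAB' := isCompl_toSubmodule.1 hAB
    let q : U →ₗ[k] U := A.toSubmodule.projection B.toSubmodule hAB'
    have hqσ : ∀ n u, q (σ n u) = σ n (q u) := by
      intro n u
      have h1 := Submodule.projection_add_projection_eq_self hAB' u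
      have hA := A.apply_mem_toSubmodule n (Submodule.projection_apply_mem hAB' u)
      have hB := B.apply_mem_toSubmodule n (Submodule.projection_apply_mem hAB'.symm u)
      change A.toSubmodule.projection B.toSubmodule hAB' (σ n u) = _
      conv_lhs => rw [← h1, map_add, map_add]
      rw [Submodule.projection_apply_of_mem_left hAB' hA,
        (Submodule.projection_apply_eq_zero_iff hAB').2 hB, add_zero]
    have hqq : ∀ u, q (q u) = q u := fun u =>
      Submodule.projection_apply_of_mem_left hAB' (Submodule.projection_apply_mem hAB' u)
    let g : Matrix X X k := LinearMap.toMatrix' (i ∘ₗ q ∘ₗ π)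
    have hg : ∀ v, g *ᵥ v = i (q (π v)) := fun v => LinearMap.toMatrix'_mulVec _ v
    have hgmem : g ∈ invariantSubalgebra k X N := by
      refine mem_of_forall_mulVec fun n v w hvw x => ?_
      rw [hg, hg, h.smul_right n v w hvw, hqσ, h.smul_left]
    have h1 := hf.eq_zero_or_eq g hgmem
      (Matrix.mulVec_injective (funext fun v => by
        rw [← mulVec_mulVec, hg, hg, h.apply_apply, hqq]))
      (Matrix.mulVec_injective (funext fun v => by
        rw [← mulVec_mulVec, hg, h.mulVec_apply]))
      (Matrix.mulVec_injective (funext fun v => by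
        rw [← mulVec_mulVec, hg, hg, ← h.apply_eq_mulVec, h.apply_apply]))
    rcases h1 with h1 | h1
    · left
      refine Subrepresentation.toSubmodule_injective ((Submodule.eq_bot_iff _).2 fun a ha => ?_)
      have h2 := hg (i a)
      rw [h1, zero_mulVec, h.apply_apply] at h2
      have h3 : q a = a := Submodule.projection_apply_of_mem_left hAB' ha
      rw [h3] at h2
      exact h.injective (h2.symm.trans (map_zero i).symm)
    · right
      refine Subrepresentation.toSubmodule_injective ((Submodule.eq_bot_iff _).2 fun a ha => ?_)
      have h2 := hg (i a)
      rw [h1, h.mulVec_apply, h.apply_apply] at h2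
      have h3 : q a = 0 := (Submodule.projection_apply_eq_zero_iff hAB').2 ha
      rw [h3, map_zero] at h2
      exact h.injective (h2.trans (map_zero i).symm)

end IsRealizedBy

end Realization

end PermMatrix

/-! ### The Brauer construction of a summand of a permutation module. -/

namespace PermMatrix

open Matrix MulAction Representation

variable {k X : Type*} [Field k]

section Brauer

variable {G : Type*} [Group G] [MulAction G X]

variable (k X) in
open scoped Classical in
/-- The restriction of functions to the fixed points of `Q`, extended by zero. -/
noncomputable def restrictFixed (Q : Subgroup G) : (X → k) →ₗ[k] (X → k) where
  toFun v x := if Q ≤ stabilizer G x then v x else 0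
  map_add' v w := by ext x; simp only [Pi.add_apply]; split_ifs <;> simp
  map_smul' c v := by ext x; simp

theorem restrictFixed_apply {Q : Subgroup G} {x : X} (hx : Q ≤ stabilizer G x) (v : X → k) :
    restrictFixed k X Q v x = v x := if_pos hx

theorem restrictFixed_apply_eq_zero {Q : Subgroup G} {x : X} (hx : ¬ Q ≤ stabilizer G x)
    (v : X → k) : restrictFixed k X Q v x = 0 := if_neg hx

theorem restrictFixed_smul {Q : Subgroup G} {n : G}
    (hn : n ∈ Subgroup.normalizer (Q : Set G)) {v w : X → k} (hvw : ∀ x, w (n • x) = v x) (x : X) :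
    restrictFixed k X Q w (n • x) = restrictFixed k X Q v x := by
  classical
  exact if_congr (le_stabilizer_smul_iff hn x) (hvw x) rfl

variable [Fintype X]

theorem restrictFixed_mulVec (Q : Subgroup G) (e : Matrix X X k) (v : X → k) :
    restrictFixed k X Q (e *ᵥ restrictFixed k X Q v) = br Q e *ᵥ v := by
  ext x
  by_cases hx : Q ≤ stabilizer G x
  · rw [restrictFixed_apply hx]
    refine Finset.sum_congr rfl fun y _ => ?_
    change e x y * _ = br Q e x y * v y
    by_cases hy : Q ≤ stabilizer G y
    · rw [restrictFixed_apply hy, br_apply _ hx hy]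
    · rw [restrictFixed_apply_eq_zero hy, br_apply_right _ _ hy, mul_zero, zero_mul]
  · rw [restrictFixed_apply_eq_zero hx]
    refine (Finset.sum_eq_zero fun y _ => ?_).symm
    change br Q e x y * v y = 0
    rw [br_apply_left _ _ hx, zero_mul]

variable {V : Type*} [AddCommGroup V] [Module k V] {ρ : Representation k G V}
  {e : Matrix X X k} {i : V →ₗ[k] X → k} {π : (X → k) →ₗ[k] V}

/-- At a point fixed by `Q`, all terms of a relative trace from `R < Q` have the same value, and
their number is a positive power of `p`. -/
theorem IsRealizedBy.restrictFixed_eq_zero [Finite G] (p : ℕ) [Fact p.Prime] [CharP k p]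
    (h : IsRealizedBy ρ e i π) {Q : Subgroup G} (hQ : IsPGroup p Q) {v : V}
    (hv : v ∈ brauerKer ρ Q) : restrictFixed k X Q (i v) = 0 := by
  suffices hle : brauerKer ρ Q ≤ LinearMap.ker (restrictFixed k X Q ∘ₗ i) from hle hv
  refine iSup₂_le fun R hR => ?_
  rintro _ ⟨m, -, rfl⟩
  rw [LinearMap.mem_ker]
  ext x
  change restrictFixed k X Q (i _) x = 0
  by_cases hx : Q ≤ stabilizer G x
  swap
  · rw [restrictFixed_apply_eq_zero hx]
  have := Fintype.ofFinite (Q ⧸ R.subgroupOf Q)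
  rw [restrictFixed_apply hx, finsum_eq_sum_of_fintype, LinearMap.sum_apply, map_sum,
    Finset.sum_apply]
  have h1 : ∀ q : Q, i (ρ q m) x = i m x := by
    intro q
    have hq : (q : G) • x = x := hx q.2
    have := h.smul_left q m x
    rwa [hq] at this
  rw [Finset.sum_congr rfl fun q _ => h1 q.out, Finset.sum_const, Finset.card_univ, nsmul_eq_mul,
    ← Nat.card_eq_fintype_card]
  obtain ⟨n, hn⟩ := hQ.index (R.subgroupOf Q)
  rw [Subgroup.index] at hn
  have hn0 : n ≠ 0 := by
    rintro rfl
    have h2 : (R.subgroupOf Q).index = 1 := hn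
    rw [Subgroup.index_eq_one, Subgroup.subgroupOf_eq_top] at h2
    exact hR.not_ge h2
  rw [hn, Nat.cast_pow, CharP.cast_eq_zero, zero_pow hn0, zero_mul]

variable [DecidableEq X]

open scoped Classical in
/-- The sum over a nontrivial orbit of `Q` is a relative trace. -/
theorem IsRealizedBy.apply_indicator_mem [Finite G] (h : IsRealizedBy ρ e i π) {Q : Subgroup G}
    {x : X} (hx : ¬ Q ≤ stabilizer G x) :
    π ((orbit Q x).indicator 1) ∈ brauerKer ρ Q := by
  have hlt : Q ⊓ stabilizer G x < Q :=
    lt_of_le_of_ne inf_le_left fun heq => hx (heq ▸ inf_le_right)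
  refine le_iSup₂_of_le (f := fun (R : Subgroup G) (_ : R < Q) => relTraceImage ρ R Q)
    _ hlt le_rfl ?_
  have hsingle : ∀ g : G, π (Pi.single (g • x) 1) = ρ g (π (Pi.single x 1)) := fun g =>
    h.smul_right g _ _ fun z => by simp only [Pi.single_apply, smul_left_cancel_iff]
  refine ⟨π (Pi.single x 1), fun r => ?_, ?_⟩
  · have hr : (r : G) • x = x := r.2.2
    have := hsingle r
    rw [hr] at this
    exact this.symm
  · set R := Q ⊓ stabilizer G x
    have := Fintype.ofFinite (Q ⧸ R.subgroupOf Q)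
    rw [finsum_eq_sum_of_fintype, LinearMap.sum_apply]
    rw [Finset.sum_congr rfl fun q _ => (hsingle _).symm, ← map_sum]
    congr 1
    ext z
    rw [Finset.sum_apply]
    have hmem : ∀ a b : Q, a • x = b • x ↔ (a : Q ⧸ R.subgroupOf Q) = b := by
      intro a b
      have h1 : ((a⁻¹ * b : Q) : G) ∈ R ↔ (a⁻¹ * b) • x = x :=
        ⟨fun h => h.2, fun h => ⟨(a⁻¹ * b).2, h⟩⟩
      rw [QuotientGroup.eq, Subgroup.mem_subgroupOf, h1, mul_smul, inv_smul_eq_iff, eq_comm]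
    by_cases hz : z ∈ orbit Q x
    · obtain ⟨q, rfl⟩ := hz
      rw [Set.indicator_of_mem (mem_orbit x q), Pi.one_apply,
        Finset.sum_eq_single (q : Q ⧸ R.subgroupOf Q)]
      · have h1 : (q : Q ⧸ R.subgroupOf Q).out • x = q • x :=
          (hmem _ _).2 (Quotient.out_eq _)
        have h2 : (((q : Q ⧸ R.subgroupOf Q).out : Q) : G) • x = q • x := h1
        rw [h2]
        exact Pi.single_eq_same _ _
      · intro c _ hc
        refine Pi.single_eq_of_ne (fun h1 => hc ?_) _
        have h2 : q • x = c.out • x := h1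
        rw [hmem] at h2
        rw [h2]
        exact (Quotient.out_eq c).symm
      · simp
    · rw [Set.indicator_of_notMem hz]
      refine Finset.sum_eq_zero fun c _ => Pi.single_eq_of_ne (fun h1 => hz ?_) _
      exact ⟨c.out, h1.symm⟩

/-- An invariant function that vanishes on the fixed points of `Q` is a sum of relative traces. -/
theorem IsRealizedBy.apply_mem_brauerKer [Finite G] (h : IsRealizedBy ρ e i π) {Q : Subgroup G}
    {v : X → k} (hv : ∀ q ∈ Q, ∀ x, v (q • x) = v x) (hv0 : ∀ x, Q ≤ stabilizer G x → v x = 0) :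
    π v ∈ brauerKer ρ Q := by
  classical
  have := Fintype.ofFinite (orbitRel.Quotient Q X)
  have hsum : v = ∑ ω : orbitRel.Quotient Q X,
      v ω.out • (orbit Q (ω.out : X)).indicator (1 : X → k) := by
    ext z
    rw [Finset.sum_apply, Finset.sum_eq_single (Quotient.mk'' z)]
    · have hz : z ∈ orbit Q ((Quotient.mk'' z : orbitRel.Quotient Q X).out : X) :=
        orbitRel_apply.1 (Quotient.exact (Quotient.out_eq _).symm)
      rw [Pi.smul_apply, Set.indicator_of_mem hz, Pi.one_apply, smul_eq_mul, mul_one]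
      obtain ⟨q, hq⟩ := hz
      conv_lhs => rw [← hq]
      exact hv q q.2 _
    · intro ω _ hω
      rw [Pi.smul_apply, Set.indicator_of_notMem, smul_zero]
      intro hz
      refine hω ?_
      rw [← Quotient.out_eq ω]
      exact (Quotient.sound' (orbitRel_apply.2 hz)).symm
    · simp
  rw [hsum, map_sum]
  refine Submodule.sum_mem _ fun ω _ => ?_
  rw [map_smul]
  by_cases hω : Q ≤ stabilizer G (ω.out : X)
  · rw [hv0 _ hω, zero_smul]
    exact Submodule.zero_mem _
  · exact Submodule.smul_mem _ _ (h.apply_indicator_mem hω)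

/-- The Brauer construction of the image of `e` is the image of `br Q e`. -/
theorem IsRealizedBy.exists_brauer [Finite G] (p : ℕ) [Fact p.Prime] [CharP k p]
    (h : IsRealizedBy ρ e i π) {Q : Subgroup G} (hQ : IsPGroup p Q) :
    ∃ i' π', IsRealizedBy (brauer ρ Q) (br Q e) i' π' := by
  have hfix : ∀ v ∈ fixedBy ρ Q, ∀ q ∈ Q, ∀ x, i v (q • x) = i v x := by
    intro v hv q hq x
    have h1 := h.smul_left q v x
    have h2 : ρ q v = v := hv ⟨q, hq⟩
    rwa [h2] at h1
  have hres : ∀ v : X → k, ∀ q ∈ Q, ∀ x,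
      restrictFixed k X Q v (q • x) = restrictFixed k X Q v x := by
    intro v q hq x
    have hqN := Subgroup.le_normalizer (H := Q) hq
    by_cases hx : Q ≤ stabilizer G x
    · have h1 : q • x = x := hx hq
      rw [h1]
    · rw [restrictFixed_apply_eq_zero hx, restrictFixed_apply_eq_zero fun h1 =>
        hx ((le_stabilizer_smul_iff hqN x).1 h1)]
  have hπ : ∀ v : X → k, π (restrictFixed k X Q v) ∈ fixedBy ρ Q := by
    intro v q
    exact (h.smul_right q _ _ (hres v q q.2)).symm
  let i' : BrauerQuotient ρ Q →ₗ[k] X → k :=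
    ((brauerKer ρ Q).submoduleOf (fixedBy ρ Q)).liftQ
      (restrictFixed k X Q ∘ₗ i ∘ₗ (fixedBy ρ Q).subtype)
      (fun v hv => h.restrictFixed_eq_zero p hQ hv)
  let π' : (X → k) →ₗ[k] BrauerQuotient ρ Q :=
    ((brauerKer ρ Q).submoduleOf (fixedBy ρ Q)).mkQ ∘ₗ
      (π ∘ₗ restrictFixed k X Q).codRestrict (fixedBy ρ Q) hπ
  refine ⟨i', π', ?_, ?_, ?_, ?_⟩
  · intro u
    obtain ⟨v, rfl⟩ := Submodule.mkQ_surjective _ u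
    refine ((Submodule.Quotient.eq _).2 ?_).symm
    -- The difference is `π` applied to `i v` with its values on the `Q`-fixed points removed, hence
    -- a sum of relative traces.
    change (v : V) - π (restrictFixed k X Q (restrictFixed k X Q (i v))) ∈ brauerKer ρ Q
    nth_rewrite 1 [← h.apply_apply (v : V)]
    rw [← map_sub]
    refine h.apply_mem_brauerKer (fun q hq x => ?_) (fun x hx => ?_)
    · rw [Pi.sub_apply, Pi.sub_apply, hfix v v.2 q hq, hres _ q hq]
    · rw [Pi.sub_apply, restrictFixed_apply hx, restrictFixed_apply hx, sub_self]
  · intro v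
    change restrictFixed k X Q (i (π (restrictFixed k X Q v))) = _
    rw [h.apply_eq_mulVec, restrictFixed_mulVec]
  · intro n u x
    obtain ⟨v, rfl⟩ := Submodule.mkQ_surjective _ u
    exact restrictFixed_smul n.2 (h.smul_left n v) x
  · intro n v w hvw
    have h1 : π (restrictFixed k X Q w) = ρ n (π (restrictFixed k X Q v)) :=
      h.smul_right n _ _ (restrictFixed_smul n.2 hvw)
    exact congrArg ((brauerKer ρ Q).submoduleOf (fixedBy ρ Q)).mkQ (Subtype.ext h1)

end Brauer

end PermMatrix

/-! ### Induced modules as functions on an orbit; Scott modules as Scott idempotents. -/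

namespace PermMatrix

open Matrix MulAction Representation

variable {k X : Type*} [Field k] {N : Type*} [Group N] [MulAction N X] {H : Subgroup N} {y : X}

section Induced

/-- Generators of the induced module depend only on the right coset `H g`, and `n` sends the one of
`g` to that of `g * n⁻¹`. The equivariant matching with the orbit therefore pairs `H g` with `g⁻¹ •
y`, which explains the inverses below. -/
theorem indV_mk_mul (h : H) (g : N) : IndV.mk H.subtype (trivial k H k) (h * g) 1 =
    IndV.mk H.subtype (trivial k H k) g 1 := by
  have := Coinvariants.mk_self_apply
    (Representation.tprod ((leftRegular k N).comp H.subtype) (trivial k H k)) h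
    (TensorProduct.tmul k (MonoidAlgebra.single g 1) 1)
  simpa using this

open scoped Classical in
/-- The map from `Ind_H^N(k)` to `k^X` onto the functions supported on an orbit with stabilizer
`H`. -/
noncomputable def indToFun (hy : stabilizer N y = H) :
    IndV H.subtype (trivial k H k) →ₗ[k] X → k :=
  Coinvariants.lift _ ((_root_.TensorProduct.rid k (X → k)).toLinearMap ∘ₗ
    ((Finsupp.lsum k fun g : N => LinearMap.toSpanSingleton k (X → k) (Pi.single (g⁻¹ • y) 1)) ∘ₗ
      (MonoidAlgebra.coeffLinearEquiv k).toLinearMap).rTensor k) (by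
    intro h
    ext g z
    have hh : (h : N)⁻¹ • y = y := by
      have : (h : N)⁻¹ ∈ stabilizer N y := hy ▸ H.inv_mem h.2
      exact this
    simp [mul_smul, hh])

open scoped Classical in
theorem indToFun_mk (hy : stabilizer N y = H) (g : N) :
    indToFun (k := k) hy (IndV.mk H.subtype (trivial k H k) g 1) = Pi.single (g⁻¹ • y) 1 := by
  simp [indToFun]

open scoped Classical in
variable (k H y) in
/-- The basis vector of `Ind_H^N(k)` that belongs to a point of the orbit of `y`. -/
noncomputable def indBasis (x : X) : IndV H.subtype (trivial k H k) :=
  if h : x ∈ orbit N y then IndV.mk H.subtype (trivial k H k) h.choose⁻¹ 1 else 0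

theorem indBasis_smul (hy : stabilizer N y = H) (g : N) :
    indBasis k H y (g • y) = IndV.mk H.subtype (trivial k H k) g⁻¹ 1 := by
  have h : g • y ∈ orbit N y := mem_orbit y g
  have h1 : indBasis k H y (g • y) = IndV.mk H.subtype (trivial k H k) h.choose⁻¹ 1 := dif_pos h
  have h2 : h.choose • y = g • y := h.choose_spec
  generalize h.choose = m at h1 h2
  have h3 : m⁻¹ * g ∈ H := by
    rw [← hy, mem_stabilizer_iff, mul_smul, ← h2, inv_smul_smul]
  rw [h1, ← indV_mk_mul ⟨_, h3⟩ g⁻¹, mul_inv_cancel_right]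

theorem indBasis_eq_zero {x : X} (hx : x ∉ orbit N y) : indBasis k H y x = 0 := dif_neg hx

theorem ind_indBasis (hy : stabilizer N y = H) (n : N) (x : X) :
    indTrivial k H n (indBasis k H y x) = indBasis k H y (n • x) := by
  by_cases hx : x ∈ orbit N y
  · obtain ⟨g, rfl⟩ := hx
    change indTrivial k H n (indBasis k H y (g • y)) = indBasis k H y (n • g • y)
    rw [← mul_smul, indBasis_smul hy, indBasis_smul hy, _root_.mul_inv_rev]
    exact ind_mk ..
  · rw [indBasis_eq_zero hx, indBasis_eq_zero fun h => hx ((smul_mem_orbit_iff _ _ _).1 h), map_zero]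

theorem indToFun_ind (hy : stabilizer N y = H) (n : N) (w : IndV H.subtype (trivial k H k))
    (x : X) : indToFun hy (indTrivial k H n w) (n • x) = indToFun hy w x := by
  classical
  suffices h : (LinearMap.funLeft k k (n • · : X → X)) ∘ₗ indToFun hy ∘ₗ indTrivial k H n =
      indToFun hy from congrFun (LinearMap.congr_fun h w) x
  refine IndV.hom_ext _ _ fun g => LinearMap.ext_ring ?_
  ext x
  change indToFun hy (indTrivial k H n (IndV.mk H.subtype (trivial k H k) g 1)) (n • x) =
    indToFun hy (IndV.mk H.subtype (trivial k H k) g 1) x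
  rw [ind_mk, indToFun_mk, indToFun_mk, _root_.mul_inv_rev, inv_inv, mul_smul, Pi.single_apply,
    Pi.single_apply]
  simp only [smul_left_cancel_iff]

theorem indToFun_eq_zero (hy : stabilizer N y = H) (w : IndV H.subtype (trivial k H k))
    {x : X} (hx : x ∉ orbit N y) : indToFun hy w x = 0 := by
  classical
  suffices h : LinearMap.proj x ∘ₗ indToFun (k := k) hy = 0 from LinearMap.congr_fun h w
  refine IndV.hom_ext _ _ fun g => LinearMap.ext_ring ?_
  change indToFun hy (IndV.mk H.subtype (trivial k H k) g 1) x = 0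
  rw [indToFun_mk]
  refine Pi.single_eq_of_ne (fun h => hx ?_) _
  rw [h]
  exact mem_orbit y _

variable [Fintype X]

variable (k H y) in
/-- The map from `k^X` to `Ind_H^N(k)` that is inverse to `indToFun` on the functions supported on
the orbit. -/
noncomputable def funToInd : (X → k) →ₗ[k] IndV H.subtype (trivial k H k) :=
  ∑ x, (LinearMap.proj x : (X → k) →ₗ[k] k).smulRight (indBasis k H y x)

theorem funToInd_apply (v : X → k) : funToInd k H y v = ∑ x, v x • indBasis k H y x := by
  simp [funToInd]

theorem funToInd_smul (hy : stabilizer N y = H) (n : N) {v w : X → k}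
    (hvw : ∀ x, w (n • x) = v x) : funToInd k H y w = indTrivial k H n (funToInd k H y v) := by
  rw [funToInd_apply, funToInd_apply, map_sum, ← Equiv.sum_comp (MulAction.toPerm n)]
  refine Finset.sum_congr rfl fun x _ => ?_
  rw [toPerm_apply, hvw, map_smul, ind_indBasis hy]

theorem funToInd_indToFun (hy : stabilizer N y = H) (w : IndV H.subtype (trivial k H k)) :
    funToInd k H y (indToFun hy w) = w := by
  classical
  suffices h : funToInd k H y ∘ₗ indToFun hy = LinearMap.id from LinearMap.congr_fun h w
  refine IndV.hom_ext _ _ fun g => LinearMap.ext_ring ?_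
  change funToInd k H y (indToFun hy (IndV.mk H.subtype (trivial k H k) g 1)) =
    IndV.mk H.subtype (trivial k H k) g 1
  rw [indToFun_mk, funToInd_apply, Finset.sum_eq_single (g⁻¹ • y)]
  · rw [Pi.single_eq_same, one_smul, indBasis_smul hy, inv_inv]
  · intro x _ hx
    rw [Pi.single_eq_of_ne hx, zero_smul]
  · simp

end Induced

/-- The Scott module `S(N, H)` is the image of a Scott idempotent on every set that contains an
orbit with stabilizer `H`. -/
theorem exists_isScottIdempotent [Fintype X] [DecidableEq X] [Finite N]
    (hy : stabilizer N y = H) :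
    ∃ (f : Matrix X X k) (i : (scottModule k H).toSubmodule →ₗ[k] X → k)
      (π : (X → k) →ₗ[k] (scottModule k H).toSubmodule),
      IsScottIdempotent N y f ∧ IsRealizedBy (scottRep k H) f i π := by
  obtain ⟨⟨T, hT⟩, hindec, hinv⟩ : IsScottSummand (indTrivial k H) (scottModule k H) :=
    (exists_scottModule k H).choose_spec
  have hT' := isCompl_toSubmodule.1 hT
  set S := (scottModule k H).toSubmodule
  let q := S.projectionOnto T.toSubmodule hT'
  have hq : ∀ (n : N) w, q (indTrivial k H n w) = scottRep k H n (q w) := by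
    intro n w
    have h1 := Submodule.projection_add_projection_eq_self hT' w
    have hA := (scottModule k H).apply_mem_toSubmodule n (Submodule.projection_apply_mem hT' w)
    have hB := T.apply_mem_toSubmodule n (Submodule.projection_apply_mem hT'.symm w)
    conv_lhs => rw [← h1, map_add, map_add]
    rw [(Submodule.projectionOnto_apply_eq_zero_iff hT').2 hB, add_zero,
      Submodule.projectionOnto_apply_of_mem_left hT' hA]
    rfl
  let i : S →ₗ[k] X → k := indToFun hy ∘ₗ S.subtype
  let π : (X → k) →ₗ[k] S := q ∘ₗ funToInd k H y
  let f : Matrix X X k := LinearMap.toMatrix' (i ∘ₗ π)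
  have hreal : IsRealizedBy (scottRep k H) f i π := by
    refine ⟨fun u => ?_, fun v => (LinearMap.toMatrix'_mulVec (i ∘ₗ π) v).symm,
      fun n u x => indToFun_ind hy n u.1 x, fun n v w hvw => ?_⟩
    · change q (funToInd k H y (indToFun hy u)) = u
      rw [funToInd_indToFun]
      exact Submodule.projectionOnto_apply_left hT' u
    · change q (funToInd k H y w) = _
      rw [funToInd_smul hy n hvw, hq]
      rfl
  have hentry : ∀ u v, f u v = i (π (Pi.single v 1)) u := by
    intro u v
    rw [hreal.apply_eq_mulVec, mulVec_single_one]
    rfl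
  have hright : ∀ u v, v ∉ orbit N y → f u v = 0 := by
    intro u v hv
    have h0 : π (Pi.single v 1) = 0 := by
      change q (funToInd k H y (Pi.single v 1)) = 0
      rw [funToInd_apply, Finset.sum_eq_single v, indBasis_eq_zero hv, smul_zero, map_zero]
      · intro x _ hx
        rw [Pi.single_eq_of_ne hx, zero_smul]
      · simp
    rw [hentry, h0, map_zero]
    rfl
  refine ⟨f, i, π, ⟨hreal.isIndecomposable_iff.1 hindec, fun u v hu => ?_, hright, ?_⟩,
    hreal⟩
  · rw [hentry]
    exact indToFun_eq_zero hy _ hu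
  -- A nonzero invariant vector becomes a function that is a nonzero constant on the orbit and zero
  -- elsewhere. Since `f` fixes it, the row sums over the orbit are 1.
  · obtain ⟨w, hw, hw0⟩ := Submodule.exists_mem_ne_zero_of_ne_bot hinv
    have hconst : ∀ n : N, i w (n • y) = i w y := by
      intro n
      have h1 := hreal.smul_left n w y
      have h2 : scottRep k H n w = w := hw n
      rwa [h2] at h1
    have hne : i w y ≠ 0 := by
      intro h0
      refine hw0 (hreal.injective ?_)
      rw [map_zero]
      ext x
      by_cases hx : x ∈ orbit N y
      · obtain ⟨n, rfl⟩ := hx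
        exact (hconst n).trans h0
      · exact indToFun_eq_zero hy _ hx
    rintro _ ⟨n, rfl⟩
    have h1 := congrFun (hreal.mulVec_apply w) (n • y)
    rw [hconst] at h1
    refine mul_right_cancel₀ hne ?_
    rw [one_mul, Finset.sum_mul]
    refine Eq.trans ?_ h1
    refine Finset.sum_congr rfl fun x _ => ?_
    change f (n • y) x * i w y = f (n • y) x * i w x
    by_cases hx : x ∈ orbit N y
    · obtain ⟨m, rfl⟩ := hx
      change _ = _ * i w (m • y)
      rw [hconst]
    · rw [hright _ x hx, zero_mul, zero_mul]

end PermMatrix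

/-! ### Translation of both conditions into idempotents. -/

theorem theorem2 {k : Type*} [Field k] [IsAlgClosed k] (p : ℕ) [Fact p.Prime] [CharP k p]
    {G : Type*} [Group G] [Finite G] (P : Subgroup G) (hP : IsPGroup p P)
    (hsat : Fusion.IsSaturated p P) :
    (Representation.scottRep k P).IsBrauerIndecomposable p ↔
      ∀ Q : Subgroup G, P.normalCore ≤ Q → Q ≤ P → Fusion.IsFullyNormalized P Q →
        (Representation.resQC Q (Representation.scottRep k
          (P.subgroupOf (Subgroup.normalizer (Q : Set G))))).IsIndecomposable := by
  classical
  have := Fintype.ofFinite (G ⧸ P)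
  have hstab : MulAction.stabilizer G ((1 : G) : G ⧸ P) = P :=
    MulAction.stabilizer_quotient P
  have hstabN : ∀ Q : Subgroup G,
      MulAction.stabilizer (Subgroup.normalizer (Q : Set G)) ((1 : G) : G ⧸ P) =
        P.subgroupOf (Subgroup.normalizer (Q : Set G)) := by
    intro Q
    ext n
    have h : (n : G) ∈ MulAction.stabilizer G ((1 : G) : G ⧸ P) ↔ (n : G) ∈ P := by rw [hstab]
    exact h
  obtain ⟨e, i, π, he, hreal⟩ := PermMatrix.exists_isScottIdempotent (k := k) hstab
  -- All the modules `S(N_G(Q), N_P(Q))` are realized on the one set `G ⧸ P`, so that `f Q` and `br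
  -- Q e` are matrices of the same shape.
  choose f j τ hf hfreal using fun Q : Subgroup G =>
    PermMatrix.exists_isScottIdempotent (k := k) (hstabN Q)
  have hmain := PermMatrix.forall_br_isPrimitive_iff p hP hsat he f fun Q _ => hf Q
  have h2 : ∀ Q : Subgroup G, (Representation.resQC Q (Representation.scottRep k
      (P.subgroupOf (Subgroup.normalizer (Q : Set G))))).IsIndecomposable ↔
      PermMatrix.IsPrimitive ↥(Q ⊔ Subgroup.centralizer (Q : Set G)) (f Q) := fun Q =>
    (hfreal Q).resQC.isIndecomposable_iff
  simp only [h2]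
  rw [← hmain]
  refine forall₂_congr fun Q hQ => ?_
  obtain ⟨i', π', hbr⟩ := hreal.exists_brauer p hQ
  rw [hbr.resQC.isIndecomposable_iff, ← hbr.eq_zero_iff, or_comm]
  exact Iff.rfl
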